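/- Let $d\ge 1$, $r,p\ge 0$ be integers. On a probability space, let $\{X_t\}_{t\in\mathbb Z}$ be an $\mathbb R^d$-valued series satisfying (almost surely, for every $t$) the dynamic factor model $$X_t=\Lambda f_t+\epsilon_t,\qquad f_t=\sum_{i=1}^p\Phi_i f_{t-i}+\eta_t ,$$ where $\Lambda\in\mathbb R^{d\times r}$, $\Phi_i\in\mathbb R^{r\times r}$, $\{f_t\}$ is a zero-mean second-order stationary $\mathbb R^r$-valued series, $\{\epsilon_t\}\sim\mathrm{WN}(0,I_d)$, $\{\eta_t\}\sim\mathrm{WN}(0,\Sigma_\eta)$, $E\,\epsilon_s f_t'=0$ for all $s,t$, and $\Lambda'\Lambda=dI_r$. Here $\{w_t\}\sim \mathrm{WN}(0,\Sigma)$ means that $w_t$ is square integrable with $E w_t=0$, $E w_tw_t'=\Sigma$ and $E w_sw_t'=0$ for $s\ne t$. Put $\widetilde\Phi_i=\frac1d\Lambda\Phi_i\Lambda'$ $(i=1,\dots,p)$, $$Z_t=\Lambda\eta_t+\epsilon_t-\sum_{i=1}^p\widetilde\Phi_i\epsilon_{t-i},\qquad W_t=\tfrac1{\sqrt d}\Lambda'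 Z_t .$$ For a zero-mean stationary series $Y$ with $\Gamma_Y(h)=E\,Y_{t+h}Y_t'$, the innovations algorithm is the recursion $\Sigma^Y_0=\Gamma_Y(0)$, $$\Theta^Y_{n,n-k}=\Big(\Gamma_Y(n-k)-\sum_{j=0}^{k-1}\Theta^Y_{n,n-j}\Sigma^Y_j(\Theta^Y_{k,k-j})'\Big)(\Sigma^Y_k)^{-1}\ (0\le k<n),\qquad \Sigma^Y_n=\Gamma_Y(0)-\sum_{j=0}^{n-1}\Theta^Y_{n,n-j}\Sigma^Y_j(\Theta^Y_{n,n-j})' .$$ Then $\{Z_t\}$ is zero-mean and stationary with $\Gamma_Z(0)=\Lambda\Sigma_\eta\Lambda'+I_d+\sum_{i=1}^p\widetilde\Phi_i\widetilde\Phi_i'$, $\Gamma_Z(h)=-\widetilde\Phi_h+\sum_{i=1}^{p-h}\widetilde\Phi_{i+h}\widetilde\Phi_i'$ for $1\le h\le p$, and $\Gamma_Z(h)=0$ for $h>p$; all $\Sigma^Z_n$ and $\Sigma^W_n$ are positive definite; and: 1. There are $\Sigma_\zeta,\Theta_1,\dots,\Theta_p\in\mathbb R^{d\times d}$ and $\{\zeta_t\}\sim\mathrm{WN}(0,\Sigma_\zeta)$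 on the same probability space such that, almost surely for every $t$, $$X_t=\sum_{i=1}^p\widetilde\Phi_iX_{t-i}+\zeta_t+\sum_{i=1}^p\Theta_i\zeta_{t-i},$$ with $\Sigma_\zeta=\lim_{n\to\infty}\Sigma^Z_n$ and $\Theta_i=\lim_{n\to\infty}\Theta^Z_{n,i}$ for $i=1,\dots,p$. Moreover $(\Sigma_\zeta,\Theta_1,\dots,\Theta_p)$ is a solution, with $\Sigma_\zeta$ symmetric, of the system $$\Gamma_Z(h)=\sum_{i=0}^{p-h}\Theta_{i+h}\Sigma_\zeta\Theta_i',\qquad h=0,1,\dots,p,\quad \Theta_0=I_d,$$ and $\Sigma_\zeta$ is maximal: for every solution $(\Sigma',\Theta_1',\dots,\Theta_p')$ of the system with $\Sigma'$ symmetric, $\Sigma_\zeta-\Sigma'$ is positive semidefinite. It is the only solution with this $\Sigma_\zeta$. 2. There are $U,V_1,\dots,V_p\in\mathbb R^{r\times r}$ with $I_r+U$ symmetric positive definite such that $$\Sigma_\zeta=I_d+\tfrac1d\Lambda U\Lambda',\qquad \Theta_i=\tfrac1d\Lambda V_i\Lambda',\quad i=1,\dots,p,$$ and there is $\{\xi_t\}\sim\mathrm{WN}(0,I_r+U)$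 on the same probability space with $W_t=\xi_t+\sum_{i=1}^pV_i\xi_{t-i}$ almost surely for every $t$. Furthermore $U=\lim_{n\to\infty}\Sigma^W_n-I_r$ and $V_i=\lim_{n\to\infty}\Theta^W_{n,i}$ for $i=1,\dots,p$. -/

import Mathlib

open MeasureTheory Filter Topology Matrix

noncomputable section

namespace DFM

/-- The second-moment matrix `E[Y W']` of two random vectors. -/
def crossMoment {Ω : Type*} [MeasurableSpace Ω] (P : Measure Ω) {m n : ℕ}
    (Y : Ω → Fin m → ℝ) (W : Ω → Fin n → ℝ) : Matrix (Fin m) (Fin n) ℝ :=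
  Matrix.of fun i j => ∫ ω, Y ω i * W ω j ∂P

/-- A zero-mean vector time series indexed by `ℤ`, all of whose entries are square integrable. -/
structure IsCenteredL2 {Ω : Type*} [MeasurableSpace Ω] (P : Measure Ω) {m : ℕ}
    (Y : ℤ → Ω → Fin m → ℝ) : Prop where
  memLp : ∀ t i, MemLp (fun ω => Y t ω i) 2 P
  mean_zero : ∀ t i, ∫ ω, Y t ω i ∂P = 0

/-- `{w_t} ~ WN(0, S)`. -/
structure IsWhiteNoise {Ω : Type*} [MeasurableSpace Ω] (P : Measure Ω) {m : ℕ}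
    (w : ℤ → Ω → Fin m → ℝ) (S : Matrix (Fin m) (Fin m) ℝ) : Prop
    extends IsCenteredL2 P w where
  cov_self : ∀ t, crossMoment P (w t) (w t) = S
  uncorrelated : ∀ s t, s ≠ t → crossMoment P (w s) (w t) = 0

/-- A zero-mean, (second-order) stationary vector time series. -/
structure IsCenteredStationary {Ω : Type*} [MeasurableSpace Ω] (P : Measure Ω) {m : ℕ}
    (Y : ℤ → Ω → Fin m → ℝ) : Prop extends IsCenteredL2 P Y where
  cov_shift : ∀ s t h, crossMoment P (Y (s + h)) (Y s) = crossMoment P (Y (t + h)) (Y t)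

/-- The autocovariance function `Γ_Y(h) = E[Y_{t+h} Y_t']` of a zero-mean stationary series
(evaluated at `t = 0`). -/
def acvf {Ω : Type*} [MeasurableSpace Ω] (P : Measure Ω) {m : ℕ}
    (Y : ℤ → Ω → Fin m → ℝ) (h : ℤ) : Matrix (Fin m) (Fin m) ℝ :=
  crossMoment P (Y h) (Y 0)

/-- `{X_t}` is a dynamic factor model with loadings `L`, errors `ε ~ WN(0, Sε)` and stationary
factors `f` following a VAR(`p`) model with coefficients `Φ 1, …, Φ p` and noise
`η ~ WN(0, Sη)`; errors and factors are uncorrelated at all times. -/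
structure IsDFM {Ω : Type*} [MeasurableSpace Ω] (P : Measure Ω) {d r : ℕ} (p : ℕ)
    (L : Matrix (Fin d) (Fin r) ℝ) (Φ : ℕ → Matrix (Fin r) (Fin r) ℝ)
    (Sε : Matrix (Fin d) (Fin d) ℝ) (Sη : Matrix (Fin r) (Fin r) ℝ)
    (X : ℤ → Ω → Fin d → ℝ) (f : ℤ → Ω → Fin r → ℝ)
    (ε : ℤ → Ω → Fin d → ℝ) (η : ℤ → Ω → Fin r → ℝ) : Prop where
  factors_stationary : IsCenteredStationary P f
  errors_whiteNoise : IsWhiteNoise P ε Sε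
  noise_whiteNoise : IsWhiteNoise P η Sη
  uncorrelated : ∀ s t, crossMoment P (ε s) (f t) = 0
  model : ∀ t, ∀ᵐ ω ∂P, X t ω = L *ᵥ f t ω + ε t ω
  factors_var : ∀ t, ∀ᵐ ω ∂P,
    f t ω = ∑ i ∈ Finset.Icc 1 p, Φ i *ᵥ f (t - i) ω + η t ω

/-- `{X_t}` has the VARMA(`p`,`q`) representation with VAR matrices `A 1, …, A p`, VMA matrices
`Θ 1, …, Θ q` and error covariance `S`, for some white noise on the same probability space. -/
def IsVARMA {Ω : Type*} [MeasurableSpace Ω] (P : Measure Ω) {m : ℕ} (p q : ℕ)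
    (A Θ : ℕ → Matrix (Fin m) (Fin m) ℝ) (S : Matrix (Fin m) (Fin m) ℝ)
    (X : ℤ → Ω → Fin m → ℝ) : Prop :=
  ∃ ζ : ℤ → Ω → Fin m → ℝ, IsWhiteNoise P ζ S ∧ ∀ t, ∀ᵐ ω ∂P,
    X t ω = ∑ i ∈ Finset.Icc 1 p, A i *ᵥ X (t - i) ω + ζ t ω
      + ∑ j ∈ Finset.Icc 1 q, Θ j *ᵥ ζ (t - j) ω

/-- A VMA(`q`) representation is a VARMA(`0`,`q`) representation. -/
def IsVMA {Ω : Type*} [MeasurableSpace Ω] (P : Measure Ω) {m : ℕ} (q : ℕ)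
    (Θ : ℕ → Matrix (Fin m) (Fin m) ℝ) (S : Matrix (Fin m) (Fin m) ℝ)
    (Y : ℤ → Ω → Fin m → ℝ) : Prop :=
  IsVARMA P 0 q 0 Θ S Y

/-- `Φ̃_i = (1/d) L Φ_i L'`. -/
def phiTilde {d r : ℕ} (L : Matrix (Fin d) (Fin r) ℝ) (Φ : ℕ → Matrix (Fin r) (Fin r) ℝ)
    (i : ℕ) : Matrix (Fin d) (Fin d) ℝ :=
  (1 / (d : ℝ)) • (L * Φ i * Lᵀ)

/-- `Z_t = L η_t + ε_t - ∑_{i=1}^p Φ̃_i ε_{t-i}`. -/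
def zSeries {Ω : Type*} {d r : ℕ} (p : ℕ) (L : Matrix (Fin d) (Fin r) ℝ)
    (Φ : ℕ → Matrix (Fin r) (Fin r) ℝ) (ε : ℤ → Ω → Fin d → ℝ) (η : ℤ → Ω → Fin r → ℝ) :
    ℤ → Ω → Fin d → ℝ :=
  fun t ω => L *ᵥ η t ω + ε t ω - ∑ i ∈ Finset.Icc 1 p, phiTilde L Φ i *ᵥ ε (t - i) ω

/-- The reduced-dimension series `(1/√d) L' Y_t`. -/
def reduced {Ω : Type*} {d r : ℕ} (L : Matrix (Fin d) (Fin r) ℝ) (Y : ℤ → Ω → Fin d → ℝ) :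
    ℤ → Ω → Fin r → ℝ :=
  fun t ω => (1 / Real.sqrt d) • (Lᵀ *ᵥ Y t ω)

/-! The innovations algorithm for an autocovariance function `Γ`. `innovCoef Γ n k` is
`Θ_{n,n-k}` for `k < n`, and `innovSigma Γ n` is `Σ_n`. -/

mutual

def innovCoef {m : ℕ} (Γ : ℤ → Matrix (Fin m) (Fin m) ℝ) (n k : ℕ) :
    Matrix (Fin m) (Fin m) ℝ :=
  if _h : k < n then
    (Γ ((n : ℤ) - k)
      - ∑ j : Fin k, innovCoef Γ n j * innovSigma Γ j * (innovCoef Γ k j)ᵀ)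
      * (innovSigma Γ k)⁻¹
  else 0
termination_by (n, 0, k)

def innovSigma {m : ℕ} (Γ : ℤ → Matrix (Fin m) (Fin m) ℝ) (n : ℕ) :
    Matrix (Fin m) (Fin m) ℝ :=
  Γ 0 - ∑ j : Fin n, innovCoef Γ n j * innovSigma Γ j * (innovCoef Γ n j)ᵀ
termination_by (n, 1, 0)

end

/-- `Θ_{n,i}` of the innovations algorithm, for `1 ≤ i ≤ n` (and `0` for other `i`). -/
def innovTheta {m : ℕ} (Γ : ℤ → Matrix (Fin m) (Fin m) ℝ) (n i : ℕ) :
    Matrix (Fin m) (Fin m) ℝ :=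
  if i ≤ n then innovCoef Γ n (n - i) else 0

/-- The recursions in their usual form. -/
theorem innovSigma_zero {m : ℕ} (Γ : ℤ → Matrix (Fin m) (Fin m) ℝ) :
    innovSigma Γ 0 = Γ 0 := by
  rw [innovSigma]; simp

theorem innovTheta_rec {m : ℕ} (Γ : ℤ → Matrix (Fin m) (Fin m) ℝ) (n k : ℕ) (hk : k < n) :
    innovTheta Γ n (n - k) =
      (Γ ((n : ℤ) - k) - ∑ j ∈ Finset.range k,
        innovTheta Γ n (n - j) * innovSigma Γ j * (innovTheta Γ k (k - j))ᵀ)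
        * (innovSigma Γ k)⁻¹ := by
  have e : ∀ a b : ℕ, b < a → innovTheta Γ a (a - b) = innovCoef Γ a b := by
    intro a b h
    rw [innovTheta, if_pos (Nat.sub_le _ _), Nat.sub_sub_self h.le]
  rw [e n k hk, innovCoef, dif_pos hk, Finset.sum_range]
  congr 2
  refine Finset.sum_congr rfl fun j _ => ?_
  rw [e n j (j.2.trans hk), e k j j.2]

theorem innovSigma_rec {m : ℕ} (Γ : ℤ → Matrix (Fin m) (Fin m) ℝ) (n : ℕ) :
    innovSigma Γ n = Γ 0 - ∑ j ∈ Finset.range n,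
      innovTheta Γ n (n - j) * innovSigma Γ j * (innovTheta Γ n (n - j))ᵀ := by
  have e : ∀ a b : ℕ, b < a → innovTheta Γ a (a - b) = innovCoef Γ a b := by
    intro a b h
    rw [innovTheta, if_pos (Nat.sub_le _ _), Nat.sub_sub_self h.le]
  rw [innovSigma, Finset.sum_range]
  congr 1
  refine Finset.sum_congr rfl fun j _ => ?_
  rw [e n j j.2]

/-- `(S, Θ_1, …, Θ_p)`, with `S` symmetric and the convention `Θ_0 = I`, solves the
autocovariance system of a VMA(`p`) model:
`Γ(h) = ∑_{i=0}^{p-h} Θ_{i+h} S Θ_i'` for `h = 0, …, p`. -/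
structure SolvesACVF {m : ℕ} (Γ : ℤ → Matrix (Fin m) (Fin m) ℝ) (p : ℕ)
    (S : Matrix (Fin m) (Fin m) ℝ) (Θ : ℕ → Matrix (Fin m) (Fin m) ℝ) : Prop where
  symm : S.IsSymm
  theta_zero : Θ 0 = 1
  eqs : ∀ h : ℕ, h ≤ p →
    Γ h = ∑ i ∈ Finset.range (p - h + 1), Θ (i + h) * S * (Θ i)ᵀ

/-- `(S, Θ)` is the solution of the system whose covariance matrix is maximal in the order
`M ≥ N ↔ M - N` positive semidefinite. -/
structure IsMaximalSolution {m : ℕ} (Γ : ℤ → Matrix (Fin m) (Fin m) ℝ) (p : ℕ)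
    (S : Matrix (Fin m) (Fin m) ℝ) (Θ : ℕ → Matrix (Fin m) (Fin m) ℝ) : Prop where
  solves : SolvesACVF Γ p S Θ
  maximal : ∀ S' Θ', SolvesACVF Γ p S' Θ' → (S - S').PosSemidef
  unique : ∀ Θ', SolvesACVF Γ p S Θ' → ∀ i, 1 ≤ i → i ≤ p → Θ' i = Θ i

end DFM

end

-- Everything takes place in the Hilbert space `Lp ℝ 2 P`, where a random vector is a tuple of
-- elements and second moments are the matrices `crossGram`. The innovations algorithm is then block
-- Gram-Schmidt: `innov Γ z τ n` is the error in predicting `z (τ + n)` from the window starting at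
-- `τ`, and its Gram matrix is `innovSigma Γ n` (`crossGram_innov`).
--
-- The noise `ε_t` is orthogonal to the past of `Z` and enters `Z_t` with coefficient `I`, so `Σ_n -
-- I` is a Gram matrix. This keeps every `Σ_n`, and the limit, invertible
-- (`innovSigma_sub_one_posSemidef`). With the right end of the window fixed at `t`, two errors
-- differ by a vector with Gram matrix `Σ_n - Σ_k`. The diagonals decrease and are bounded below, so
-- the errors are Cauchy and converge to some `ζ_t` (`exists_tendsto_innov`). Since `Γ` vanishes
-- after lag `p`, only `p` coefficients survive, and the limit exhibits `Z` as a moving average of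
-- `ζ` (`series_eq_limit_add`).
--
-- For maximality, any symmetric solution `S'` is positive semidefinite (`SolvesACVF.posSemidef`)
-- and is therefore realised by a moving average in `ℓ²` with the same `Γ`. The algorithm sees only
-- `Γ`, and in that model `Σ_n - S'` is again a Gram matrix. If `S'` is the limit itself, the errors
-- converge to the noise of the model, which determines the coefficients
-- (`isMaximalSolution_of_tendsto`).
--
-- For the low-dimensional form, `Q = L / √d` has orthonormal columns. The lag-zero covariance of
-- `Z` is that of `W` on the range of `Q` and the identity on its complement, while the other lags
-- live on the range. The recursions preserve this shape (`innov_lift`), hence so do the limits.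
-- Finally `Φ̃_i L = L Φ_i` gives `X_t - ∑ Φ̃_i X_{t-i} = Z_t`.

noncomputable section

namespace DFM

-- Calculus of matrix-valued inner products.

section CrossGram

variable {H : Type*} [NormedAddCommGroup H] [InnerProductSpace ℝ H]

/-- The action of a matrix on a tuple of vectors. -/
def act {m n : ℕ} (A : Matrix (Fin m) (Fin n) ℝ) (x : Fin n → H) : Fin m → H :=
  fun i => ∑ j, A i j • x j

/-- The matrix of inner products between two tuples of vectors. -/
def crossGram {m n : ℕ} (x : Fin m → H) (y : Fin n → H) : Matrix (Fin m) (Fin n) ℝ :=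
  Matrix.of fun i j => inner ℝ (x i) (y j)

theorem crossGram_apply {m n : ℕ} (x : Fin m → H) (y : Fin n → H) (i : Fin m) (j : Fin n) :
    crossGram x y i j = inner ℝ (x i) (y j) := rfl

theorem crossGram_transpose {m n : ℕ} (x : Fin m → H) (y : Fin n → H) :
    (crossGram x y)ᵀ = crossGram y x := by
  ext i j
  exact real_inner_comm _ _

theorem crossGram_act_left {l m n : ℕ} (A : Matrix (Fin l) (Fin m) ℝ) (x : Fin m → H)
    (y : Fin n → H) : crossGram (act A x) y = A * crossGram x y := by
  ext i j
  simp [crossGram_apply, act, sum_inner, real_inner_smul_left, Matrix.mul_apply]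

theorem crossGram_act_right {l m n : ℕ} (A : Matrix (Fin l) (Fin m) ℝ) (x : Fin n → H)
    (y : Fin m → H) : crossGram x (act A y) = crossGram x y * Aᵀ := by
  rw [← crossGram_transpose, crossGram_act_left, Matrix.transpose_mul, crossGram_transpose]

theorem crossGram_add_left {m n : ℕ} (x x' : Fin m → H) (y : Fin n → H) :
    crossGram (x + x') y = crossGram x y + crossGram x' y := by
  ext i j
  simp [crossGram_apply, inner_add_left]

theorem crossGram_add_right {m n : ℕ} (x : Fin m → H) (y y' : Fin n → H) :
    crossGram x (y + y') = crossGram x y + crossGram x y' := by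
  ext i j
  simp [crossGram_apply, inner_add_right]

theorem crossGram_sub_left {m n : ℕ} (x x' : Fin m → H) (y : Fin n → H) :
    crossGram (x - x') y = crossGram x y - crossGram x' y := by
  ext i j
  simp [crossGram_apply, inner_sub_left]

theorem crossGram_sub_right {m n : ℕ} (x : Fin m → H) (y y' : Fin n → H) :
    crossGram x (y - y') = crossGram x y - crossGram x y' := by
  ext i j
  simp [crossGram_apply, inner_sub_right]

theorem crossGram_sum_left {ι : Type*} {m n : ℕ} (s : Finset ι) (x : ι → Fin m → H)
    (y : Fin n → H) : crossGram (∑ k ∈ s, x k) y = ∑ k ∈ s, crossGram (x k) y := by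
  ext i j
  simp [crossGram_apply, sum_inner, Matrix.sum_apply]

theorem crossGram_sum_right {ι : Type*} {m n : ℕ} (s : Finset ι) (x : Fin m → H)
    (y : ι → Fin n → H) : crossGram x (∑ k ∈ s, y k) = ∑ k ∈ s, crossGram x (y k) := by
  ext i j
  simp [crossGram_apply, inner_sum, Matrix.sum_apply]

theorem crossGram_posSemidef {m : ℕ} (x : Fin m → H) : (crossGram x x).PosSemidef :=
  Matrix.posSemidef_gram ℝ x

theorem act_one {m : ℕ} (x : Fin m → H) : act (1 : Matrix (Fin m) (Fin m) ℝ) x = x := by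
  ext i
  simp [act, Matrix.one_apply]

theorem act_zero {m n : ℕ} (x : Fin n → H) : act (0 : Matrix (Fin m) (Fin n) ℝ) x = 0 := by
  ext i
  simp [act]

theorem act_neg {m n : ℕ} (A : Matrix (Fin m) (Fin n) ℝ) (x : Fin n → H) :
    act (-A) x = -act A x := by
  ext i
  simp [act]

end CrossGram

-- The innovations algorithm as block Gram-Schmidt.

section Innovations

variable {H : Type*} [NormedAddCommGroup H] [InnerProductSpace ℝ H] {m : ℕ}

/-- The one-step prediction error of `z (τ + n)` given `z τ, …, z (τ + n - 1)`, as computed by the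
innovations algorithm. -/
def innov (Γ : ℤ → Matrix (Fin m) (Fin m) ℝ) (z : ℤ → Fin m → H) (τ : ℤ) (n : ℕ) : Fin m → H :=
  z (τ + n) - ∑ j : Fin n, act (innovCoef Γ n j) (innov Γ z τ j)

theorem innov_eq (Γ : ℤ → Matrix (Fin m) (Fin m) ℝ) (z : ℤ → Fin m → H) (τ : ℤ) (n : ℕ) :
    innov Γ z τ n =
      z (τ + n) - ∑ j ∈ Finset.range n, act (innovCoef Γ n j) (innov Γ z τ j) := by
  rw [innov, Finset.sum_range]

theorem innovCoef_eq (Γ : ℤ → Matrix (Fin m) (Fin m) ℝ) {n k : ℕ} (h : k < n) :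
    innovCoef Γ n k = (Γ ((n : ℤ) - k) - ∑ j ∈ Finset.range k,
      innovCoef Γ n j * innovSigma Γ j * (innovCoef Γ k j)ᵀ) * (innovSigma Γ k)⁻¹ := by
  rw [innovCoef, dif_pos h, Finset.sum_range]

theorem innovSigma_eq (Γ : ℤ → Matrix (Fin m) (Fin m) ℝ) (n : ℕ) :
    innovSigma Γ n = Γ 0 - ∑ j ∈ Finset.range n,
      innovCoef Γ n j * innovSigma Γ j * (innovCoef Γ n j)ᵀ := by
  rw [innovSigma, Finset.sum_range]

variable {Γ : ℤ → Matrix (Fin m) (Fin m) ℝ} {z : ℤ → Fin m → H}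

/-- The recursion for `innovCoef` is this identity solved for the coefficient; orthogonality of the
errors is not needed yet. -/
theorem crossGram_series_innov_of_lt (hz : ∀ s t, crossGram (z s) (z t) = Γ (s - t)) (τ : ℤ)
    {n : ℕ} (hu : ∀ k < n, IsUnit (innovSigma Γ k).det) (k : ℕ) (hk : k < n) :
    crossGram (z (τ + n)) (innov Γ z τ k) = innovCoef Γ n k * innovSigma Γ k := by
  induction k using Nat.strong_induction_on with
  | _ k ih =>
    rw [innovCoef_eq Γ hk, Matrix.nonsing_inv_mul_cancel_right _ _ (hu k hk), innov_eq,
      crossGram_sub_right, hz, crossGram_sum_right]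
    congr 1
    · congr 1; ring
    · refine Finset.sum_congr rfl fun j hj => ?_
      have hj := Finset.mem_range.1 hj
      rw [crossGram_act_right, ih j hj (hj.trans hk)]

theorem crossGram_series_innov_self (hz : ∀ s t, crossGram (z s) (z t) = Γ (s - t)) (τ : ℤ)
    {n : ℕ} (hu : ∀ k < n, IsUnit (innovSigma Γ k).det) :
    crossGram (z (τ + n)) (innov Γ z τ n) = innovSigma Γ n := by
  rw [innovSigma_eq, innov_eq, crossGram_sub_right, hz, crossGram_sum_right]
  congr 1
  · congr 1; ring
  · refine Finset.sum_congr rfl fun j hj => ?_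
    rw [crossGram_act_right, crossGram_series_innov_of_lt hz τ hu j (Finset.mem_range.1 hj)]

/-- Subtracting exactly the projections onto the earlier errors leaves something orthogonal to each
of them. In the sum over `j` only `j = k` survives, by induction. -/
theorem crossGram_innov (hz : ∀ s t, crossGram (z s) (z t) = Γ (s - t)) (τ : ℤ)
    (n : ℕ) (hu : ∀ k < n, IsUnit (innovSigma Γ k).det) :
    (∀ k < n, crossGram (innov Γ z τ n) (innov Γ z τ k) = 0) ∧
      crossGram (innov Γ z τ n) (innov Γ z τ n) = innovSigma Γ n := by
  induction n using Nat.strong_induction_on with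
  | _ n ih =>
    have key : ∀ k < n, crossGram (innov Γ z τ n) (innov Γ z τ k) = 0 := by
      intro k hk
      rw [innov_eq Γ z τ n, crossGram_sub_left, crossGram_series_innov_of_lt hz τ hu k hk,
        crossGram_sum_left, Finset.sum_eq_single k]
      · rw [crossGram_act_left, (ih k hk fun j hj => hu j (hj.trans hk)).2, sub_self]
      · intro j hj hjk
        have hj := Finset.mem_range.1 hj
        rw [crossGram_act_left]
        rcases lt_or_gt_of_ne hjk with h | h
        · rw [← crossGram_transpose, (ih k hk fun i hi => hu i (hi.trans hk)).1 j h]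
          simp
        · rw [(ih j hj fun i hi => hu i (hi.trans hj)).1 k h, Matrix.mul_zero]
      · intro h
        exact absurd (Finset.mem_range.2 hk) h
    refine ⟨key, ?_⟩
    nth_rw 1 [innov_eq Γ z τ n]
    rw [crossGram_sub_left,
      crossGram_series_innov_self hz τ hu, crossGram_sum_left, Finset.sum_eq_zero, sub_zero]
    intro j hj
    rw [crossGram_act_left, ← crossGram_transpose, key j (Finset.mem_range.1 hj)]
    simp

/-- The error differs from `z (τ + n)` by a combination of earlier terms of the window, to which `y`
is orthogonal. -/
theorem crossGram_innov_left {l : ℕ} (τ : ℤ) (y : Fin l → H) (n : ℕ)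
    (hy : ∀ j < n, crossGram (z (τ + (j : ℕ))) y = 0) :
    crossGram (innov Γ z τ n) y = crossGram (z (τ + n)) y := by
  induction n using Nat.strong_induction_on with
  | _ n ih =>
    rw [innov_eq, crossGram_sub_left, crossGram_sum_left, Finset.sum_eq_zero, sub_zero]
    intro j hj
    have hj := Finset.mem_range.1 hj
    rw [crossGram_act_left, ih j hj fun i hi => hy i (hi.trans hj), hy j hj, Matrix.mul_zero]

theorem crossGram_series_innov_eq_zero (hz : ∀ s t, crossGram (z s) (z t) = Γ (s - t)) (τ : ℤ)
    {n : ℕ} (hu : ∀ k < n, IsUnit (innovSigma Γ k).det) (k : ℕ) (hk : k < n) :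
    crossGram (z (τ + k)) (innov Γ z τ n) = 0 := by
  have h : z (τ + k) = innov Γ z τ k
      + ∑ j ∈ Finset.range k, act (innovCoef Γ k j) (innov Γ z τ j) := by
    rw [innov_eq Γ z τ k]; abel
  have h0 : ∀ j < n, crossGram (innov Γ z τ j) (innov Γ z τ n) = 0 := by
    intro j hj
    rw [← crossGram_transpose, (crossGram_innov hz τ n hu).1 j hj, Matrix.transpose_zero]
  rw [h, crossGram_add_left, h0 k hk, crossGram_sum_left, Finset.sum_eq_zero, zero_add]
  intro j hj
  rw [crossGram_act_left, h0 j ((Finset.mem_range.1 hj).trans hk), Matrix.mul_zero]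

/-- If `y` is orthogonal to the past and has second moment `B` with itself and with the present,
then the prediction error differs from `y` by an error of second moment `Σ_n - B`. -/
theorem crossGram_innov_sub (hz : ∀ s t, crossGram (z s) (z t) = Γ (s - t)) (τ : ℤ)
    {n : ℕ} (hu : ∀ k < n, IsUnit (innovSigma Γ k).det) {y : Fin m → H}
    {B : Matrix (Fin m) (Fin m) ℝ} (hy : ∀ j < n, crossGram (z (τ + (j : ℕ))) y = 0)
    (hzy : crossGram (z (τ + n)) y = B) (hyy : crossGram y y = B) :
    crossGram (innov Γ z τ n - y) (innov Γ z τ n - y) = innovSigma Γ n - B := by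
  have h1 : crossGram (innov Γ z τ n) y = B := by rw [crossGram_innov_left τ y n hy, hzy]
  have h2 : crossGram y (innov Γ z τ n) = B := by
    rw [← crossGram_transpose, h1, ← hyy, crossGram_transpose]
  rw [crossGram_sub_left, crossGram_sub_right, crossGram_sub_right, h1, h2, hyy,
    (crossGram_innov hz τ n hu).2]
  abel

theorem posDef_of_sub_one {S : Matrix (Fin m) (Fin m) ℝ} (h : (S - 1).PosSemidef) :
    S.PosDef := by
  simpa using Matrix.PosDef.one.add_posSemidef h

theorem isUnit_det_of_posDef {S : Matrix (Fin m) (Fin m) ℝ} (h : S.PosDef) : IsUnit S.det :=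
  (Matrix.isUnit_iff_isUnit_det _).1 h.isUnit

/-- The window is placed so that it ends at time `0`; then `Σ_n - 1` is the Gram matrix of the error
minus `w`. The induction supplies the invertibility of the earlier `Σ_k`. -/
theorem innovSigma_sub_one_posSemidef (hz : ∀ s t, crossGram (z s) (z t) = Γ (s - t))
    {w : Fin m → H} (hw : ∀ s < 0, crossGram (z s) w = 0) (hzw : crossGram (z 0) w = 1)
    (hww : crossGram w w = 1) (n : ℕ) : (innovSigma Γ n - 1).PosSemidef := by
  induction n using Nat.strong_induction_on with
  | _ n ih =>
    rw [← crossGram_innov_sub hz (-n)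
      (fun k hk => isUnit_det_of_posDef (posDef_of_sub_one (ih k hk)))
      (fun j hj => hw _ (by omega)) (by simpa using hzw) hww]
    exact crossGram_posSemidef _

end Innovations

-- Convergence of errors and coefficients as the window grows into the past.

section Limits

variable {H : Type*} [NormedAddCommGroup H] [InnerProductSpace ℝ H] {m : ℕ}

theorem tendsto_crossGram {α : Type*} {l : Filter α} {m n : ℕ} {x : α → Fin m → H}
    {y : α → Fin n → H} {x₀ : Fin m → H} {y₀ : Fin n → H} (hx : Tendsto x l (𝓝 x₀))
    (hy : Tendsto y l (𝓝 y₀)) :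
    Tendsto (fun a => crossGram (x a) (y a)) l (𝓝 (crossGram x₀ y₀)) :=
  tendsto_pi_nhds.2 fun i => tendsto_pi_nhds.2 fun j =>
    (tendsto_pi_nhds.1 hx i).inner (tendsto_pi_nhds.1 hy j)

theorem tendsto_act {α : Type*} {l : Filter α} {m n : ℕ} {A : α → Matrix (Fin m) (Fin n) ℝ}
    {x : α → Fin n → H} {A₀ : Matrix (Fin m) (Fin n) ℝ} {x₀ : Fin n → H}
    (hA : Tendsto A l (𝓝 A₀)) (hx : Tendsto x l (𝓝 x₀)) :
    Tendsto (fun a => act (A a) (x a)) l (𝓝 (act A₀ x₀)) :=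
  tendsto_pi_nhds.2 fun i => tendsto_finsetSum _ fun j _ =>
    (tendsto_pi_nhds.1 (tendsto_pi_nhds.1 hA i) j).smul (tendsto_pi_nhds.1 hx j)

theorem posSemidef_of_tendsto {α : Type*} {l : Filter α} [l.NeBot]
    {A : α → Matrix (Fin m) (Fin m) ℝ} {A₀ : Matrix (Fin m) (Fin m) ℝ}
    (hA : Tendsto A l (𝓝 A₀)) (h : ∀ a, (A a).PosSemidef) : A₀.PosSemidef := by
  refine Matrix.PosSemidef.of_dotProduct_mulVec_nonneg ?_ fun x => ?_
  · have h1 : Tendsto (fun a => (A a)ᴴ) l (𝓝 A₀ᴴ) :=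
      (continuous_id.matrix_conjTranspose.tendsto A₀).comp hA
    refine tendsto_nhds_unique h1 (hA.congr fun a => ?_)
    exact (h a).isHermitian.symm
  · have h1 : Continuous fun M : Matrix (Fin m) (Fin m) ℝ => star x ⬝ᵥ M *ᵥ x :=
      continuous_const.dotProduct (continuous_id.matrix_mulVec continuous_const)
    exact ge_of_tendsto' ((h1.tendsto A₀).comp hA) fun a => (h a).dotProduct_mulVec_nonneg x

theorem tendsto_matrix_inv {α : Type*} {l : Filter α}
    {A : α → Matrix (Fin m) (Fin m) ℝ} {A₀ : Matrix (Fin m) (Fin m) ℝ}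
    (hA : Tendsto A l (𝓝 A₀)) (h : IsUnit A₀.det) :
    Tendsto (fun a => (A a)⁻¹) l (𝓝 A₀⁻¹) := by
  refine (continuousAt_matrix_inv A₀ ?_).tendsto.comp hA
  rw [Ring.inverse_eq_inv']
  exact continuousAt_inv₀ h.ne_zero

variable {Γ : ℤ → Matrix (Fin m) (Fin m) ℝ} {z : ℤ → Fin m → H}

/-- The error of the longer window is orthogonal to everything in the shorter one, so it can play
the part of `y` in `crossGram_innov_sub`. -/
theorem crossGram_innov_sub_innov (hz : ∀ s t, crossGram (z s) (z t) = Γ (s - t))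
    (hu : ∀ n, IsUnit (innovSigma Γ n).det) (t : ℤ) {n k : ℕ} (hnk : n ≤ k) :
    crossGram (innov Γ z (t - n) n - innov Γ z (t - k) k)
      (innov Γ z (t - n) n - innov Γ z (t - k) k) = innovSigma Γ n - innovSigma Γ k := by
  refine crossGram_innov_sub hz _ (fun k _ => hu k) (fun j hj => ?_) ?_
    (crossGram_innov hz _ k fun k _ => hu k).2
  · have h := crossGram_series_innov_eq_zero hz (t - k) (fun k _ => hu k) (k - n + j)
      (by omega : k - n + j < k)
    rwa [show t - (k : ℤ) + ((k - n + j : ℕ) : ℤ) = t - n + j by omega] at h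
  · have h := crossGram_series_innov_self hz (t - k) (n := k) fun k _ => hu k
    rwa [show t - (k : ℤ) + k = t - n + n by ring] at h

theorem exists_tendsto_innov [CompleteSpace H]
    (hz : ∀ s t, crossGram (z s) (z t) = Γ (s - t))
    (hu : ∀ n, IsUnit (innovSigma Γ n).det) (t : ℤ) :
    ∃ ζ : Fin m → H, Tendsto (fun n : ℕ => innov Γ z (t - n) n) atTop (𝓝 ζ) := by
  suffices h : ∀ i, ∃ x : H, Tendsto (fun n : ℕ => innov Γ z (t - n) n i) atTop (𝓝 x) by
    choose ζ hζ using h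
    exact ⟨ζ, tendsto_pi_nhds.2 hζ⟩
  intro i
  -- Squared distances are differences of a real sequence that is decreasing and nonnegative, hence
  -- Cauchy.
  have hdist : ∀ n k : ℕ, n ≤ k →
      ‖innov Γ z (t - n) n i - innov Γ z (t - k) k i‖ ^ 2
        = innovSigma Γ n i i - innovSigma Γ k i i := by
    intro n k hnk
    have h := congrFun (congrFun (crossGram_innov_sub_innov hz hu t hnk) i) i
    rw [crossGram_apply, Pi.sub_apply, real_inner_self_eq_norm_sq] at h
    exact h
  have hanti : Antitone fun n => innovSigma Γ n i i := by
    intro n k hnk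
    have h := hdist n k hnk
    have h' := sq_nonneg ‖innov Γ z (t - n) n i - innov Γ z (t - k) k i‖
    show innovSigma Γ k i i ≤ innovSigma Γ n i i
    linarith
  have hbdd : BddBelow (Set.range fun n => innovSigma Γ n i i) := by
    refine ⟨0, ?_⟩
    rintro _ ⟨n, rfl⟩
    have h := congrFun (congrFun (crossGram_innov hz t n fun k _ => hu k).2 i) i
    rw [crossGram_apply, real_inner_self_eq_norm_sq] at h
    show 0 ≤ innovSigma Γ n i i
    rw [← h]
    positivity
  have hcs := (tendsto_atTop_ciInf hanti hbdd).cauchySeq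
  refine cauchySeq_tendsto_of_complete (Metric.cauchySeq_iff'.2 fun ε hε => ?_)
  obtain ⟨N, hN⟩ := Metric.cauchySeq_iff'.1 hcs (ε ^ 2) (by positivity)
  refine ⟨N, fun n hn => ?_⟩
  rw [dist_comm, dist_eq_norm]
  refine lt_of_pow_lt_pow_left₀ 2 hε.le ?_
  rw [hdist N n hn]
  have h := hN n hn
  rw [dist_comm, Real.dist_eq] at h
  exact (le_abs_self _).trans_lt h

theorem innovTheta_add (Γ : ℤ → Matrix (Fin m) (Fin m) ℝ) (n i : ℕ) :
    innovTheta Γ (n + i) i = innovCoef Γ (n + i) n := by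
  rw [innovTheta, if_pos (Nat.le_add_left _ _), Nat.add_sub_cancel]

/-- `Θ_{n+i,i} Σ_n` is the second moment of the series with the prediction errors. -/
theorem innovTheta_add_mul_innovSigma (hz : ∀ s t, crossGram (z s) (z t) = Γ (s - t))
    (hu : ∀ n, IsUnit (innovSigma Γ n).det) (t : ℤ) (n : ℕ) {i : ℕ} (hi : 1 ≤ i) :
    innovTheta Γ (n + i) i * innovSigma Γ n = crossGram (z (t + i)) (innov Γ z (t - n) n) := by
  rw [innovTheta_add, ← crossGram_series_innov_of_lt hz (t - n) (fun k _ => hu k) n (by omega)]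
  congr 2
  push_cast
  ring

theorem crossGram_limit {ζ : ℤ → Fin m → H} {S : Matrix (Fin m) (Fin m) ℝ}
    (hz : ∀ s t, crossGram (z s) (z t) = Γ (s - t)) (hu : ∀ n, IsUnit (innovSigma Γ n).det)
    (hζ : ∀ t, Tendsto (fun n : ℕ => innov Γ z (t - n) n) atTop (𝓝 (ζ t)))
    (hS : Tendsto (fun n => innovSigma Γ n) atTop (𝓝 S)) (s t : ℤ) :
    crossGram (ζ s) (ζ t) = if s = t then S else 0 := by
  have hlt : ∀ s t, s < t → crossGram (ζ t) (ζ s) = 0 := by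
    intro s t hst
    obtain ⟨k, hk⟩ := Int.le.dest hst.le
    -- Shifting the index by `k = t - s` gives both windows the same left end, so their errors
    -- belong to one Gram-Schmidt process.
    have h := tendsto_crossGram ((hζ t).comp (tendsto_add_atTop_nat k)) (hζ s)
    refine tendsto_nhds_unique h ((tendsto_const_nhds (x := 0)).congr fun n => ?_)
    have e : t - ((n + k : ℕ) : ℤ) = s - n := by push_cast; omega
    simp only [Function.comp_apply]
    rw [e, (crossGram_innov hz (s - n) (n + k) fun k _ => hu k).1 n (by omega)]
  rcases lt_trichotomy s t with h | h | h
  · rw [if_neg h.ne, ← crossGram_transpose, hlt s t h, Matrix.transpose_zero]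
  · subst h
    rw [if_pos rfl]
    exact tendsto_nhds_unique ((tendsto_crossGram (hζ s) (hζ s)).congr fun n : ℕ =>
      (crossGram_innov hz (s - n) n fun k _ => hu k).2) hS
  · rw [if_neg h.ne', hlt t s h]

theorem tendsto_innovTheta {ζ : ℤ → Fin m → H} {S : Matrix (Fin m) (Fin m) ℝ}
    (hz : ∀ s t, crossGram (z s) (z t) = Γ (s - t)) (hu : ∀ n, IsUnit (innovSigma Γ n).det)
    (hζ : ∀ t, Tendsto (fun n : ℕ => innov Γ z (t - n) n) atTop (𝓝 (ζ t)))
    (hS : Tendsto (fun n => innovSigma Γ n) atTop (𝓝 S)) (hSu : IsUnit S.det)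
    {i : ℕ} (hi : 1 ≤ i) :
    Tendsto (fun n => innovTheta Γ n i) atTop (𝓝 (crossGram (z i) (ζ 0) * S⁻¹)) := by
  rw [← tendsto_add_atTop_iff_nat i]
  have h := (tendsto_crossGram (tendsto_const_nhds (x := z i)) (hζ 0)).mul
    (tendsto_matrix_inv hS hSu)
  refine h.congr fun n => ?_
  have h1 := innovTheta_add_mul_innovSigma hz hu 0 n hi
  rw [zero_add] at h1
  rw [← h1, Matrix.mul_nonsing_inv_cancel_right _ _ (hu n)]

/-- At a lag beyond `p` the series is uncorrelated with the whole window, hence with its last error;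
invertibility of `Σ_n` then removes the factor `Σ_n`. -/
theorem innovTheta_eq_zero {p : ℕ} (hz : ∀ s t, crossGram (z s) (z t) = Γ (s - t))
    (hu : ∀ n, IsUnit (innovSigma Γ n).det) (hp : ∀ h : ℕ, p < h → Γ h = 0) (n : ℕ) {i : ℕ}
    (hi : p < i) : innovTheta Γ (n + i) i = 0 := by
  have h := innovTheta_add_mul_innovSigma hz hu 0 n (i := i) (by omega)
  have hpast : ∀ j : ℕ, j ≤ n → crossGram (z ((0 : ℤ) - n + j)) (z (0 + i)) = 0 := by
    intro j hj
    rw [← crossGram_transpose, hz,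
      show (0 : ℤ) + i - (0 - n + j) = ((i + (n - j) : ℕ) : ℤ) by omega, hp _ (by omega),
      Matrix.transpose_zero]
  have h0 : crossGram (z ((0 : ℤ) + i)) (innov Γ z (0 - n) n) = 0 := by
    rw [← crossGram_transpose, crossGram_innov_left _ _ _ fun j hj => hpast j hj.le,
      hpast n le_rfl, Matrix.transpose_zero]
  rw [← Matrix.mul_nonsing_inv_cancel_right (innovSigma Γ n) (innovTheta Γ (n + i) i) (hu n), h,
    h0, Matrix.zero_mul]

theorem series_eq_innov_add {p : ℕ} (hz : ∀ s t, crossGram (z s) (z t) = Γ (s - t))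
    (hu : ∀ n, IsUnit (innovSigma Γ n).det) (hp : ∀ h : ℕ, p < h → Γ h = 0) (t : ℤ) (n : ℕ)
    (hn : p ≤ n) :
    z t = innov Γ z (t - n) n
      + ∑ i ∈ Finset.Icc 1 p, act (innovTheta Γ n i) (innov Γ z (t - n) (n - i)) := by
  have h1 : ∑ i ∈ Finset.Icc 1 p, act (innovTheta Γ n i) (innov Γ z (t - n) (n - i))
      = ∑ i ∈ Finset.Icc 1 n, act (innovTheta Γ n i) (innov Γ z (t - n) (n - i)) := by
    refine Finset.sum_subset (Finset.Icc_subset_Icc_right hn) fun i hi hi' => ?_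
    simp only [Finset.mem_Icc, not_and, not_le] at hi hi'
    obtain ⟨k, rfl⟩ := Nat.exists_eq_add_of_le' hi.2
    rw [innovTheta_eq_zero hz hu hp k (hi' hi.1), act_zero]
  have h2 : ∑ i ∈ Finset.Icc 1 n, act (innovTheta Γ n i) (innov Γ z (t - n) (n - i))
      = ∑ j ∈ Finset.range n, act (innovCoef Γ n j) (innov Γ z (t - n) j) := by
    refine Finset.sum_bij' (fun i _ => n - i) (fun j _ => n - j) ?_ ?_ ?_ ?_ ?_
    · intro i hi; simp only [Finset.mem_Icc, Finset.mem_range] at *; omega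
    · intro j hj; simp only [Finset.mem_Icc, Finset.mem_range] at *; omega
    · intro i hi; simp only [Finset.mem_Icc] at hi; omega
    · intro j hj; simp only [Finset.mem_range] at hj; omega
    · intro i hi
      rw [innovTheta, if_pos (Finset.mem_Icc.1 hi).2]
  rw [h1, h2, innov_eq Γ z (t - n) n, sub_add_cancel, sub_add_cancel]

/-- A stationary series whose autocovariances vanish after lag `p` is a moving average of order `p`
of the limits of its finite-past prediction errors. -/
theorem series_eq_limit_add {ζ : ℤ → Fin m → H} {p : ℕ} {Θ : ℕ → Matrix (Fin m) (Fin m) ℝ}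
    (hz : ∀ s t, crossGram (z s) (z t) = Γ (s - t)) (hu : ∀ n, IsUnit (innovSigma Γ n).det)
    (hp : ∀ h : ℕ, p < h → Γ h = 0)
    (hζ : ∀ t, Tendsto (fun n : ℕ => innov Γ z (t - n) n) atTop (𝓝 (ζ t)))
    (hΘ : ∀ i, 1 ≤ i → Tendsto (fun n => innovTheta Γ n i) atTop (𝓝 (Θ i))) (t : ℤ) :
    z t = ζ t + ∑ i ∈ Finset.Icc 1 p, act (Θ i) (ζ (t - i)) := by
  have h : Tendsto (fun n : ℕ => innov Γ z (t - n) n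
      + ∑ i ∈ Finset.Icc 1 p, act (innovTheta Γ n i) (innov Γ z (t - n) (n - i))) atTop
      (𝓝 (ζ t + ∑ i ∈ Finset.Icc 1 p, act (Θ i) (ζ (t - i)))) := by
    refine (hζ t).add (tendsto_finsetSum _ fun i hi => ?_)
    refine tendsto_act (hΘ i (Finset.mem_Icc.1 hi).1) ?_
    rw [← tendsto_add_atTop_iff_nat i]
    refine (hζ (t - i)).congr fun n => ?_
    rw [Nat.add_sub_cancel]
    congr 1
    push_cast
    ring
  refine tendsto_nhds_unique (tendsto_const_nhds.congr' ?_) h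
  filter_upwards [eventually_ge_atTop p] with n hn
  exact series_eq_innov_add hz hu hp t n hn

/-- Used with `v` the constant function `1`, where orthogonality means zero mean. -/
theorem inner_innov_eq_zero {v : H} (hv : ∀ t i, inner ℝ v (z t i) = 0) (τ : ℤ) (n : ℕ)
    (i : Fin m) : inner ℝ v (innov Γ z τ n i) = 0 := by
  have h := crossGram_innov_left (Γ := Γ) (z := z) τ (fun _ : Fin 1 => v) n fun j _ => by
    ext a b; rw [crossGram_apply, real_inner_comm]; exact hv _ _
  have h' := congrFun (congrFun h i) 0
  rw [crossGram_apply, crossGram_apply] at h'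
  rw [real_inner_comm, h', real_inner_comm, hv]

theorem inner_limit_eq_zero {ζ : ℤ → Fin m → H} {v : H} (hv : ∀ t i, inner ℝ v (z t i) = 0)
    (hζ : ∀ t, Tendsto (fun n : ℕ => innov Γ z (t - n) n) atTop (𝓝 (ζ t))) (t : ℤ) (i : Fin m) :
    inner ℝ v (ζ t i) = 0 :=
  tendsto_nhds_unique ((tendsto_const_nhds (x := v)).inner (tendsto_pi_nhds.1 (hζ t) i))
    (tendsto_const_nhds.congr fun n => (inner_innov_eq_zero hv _ n i).symm)

end Limits

-- Second moments of moving averages.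

section MovingAverage

variable {H : Type*} [NormedAddCommGroup H] [InnerProductSpace ℝ H] {l m : ℕ}

theorem sum_range_sum_range_lag {M : Type*} [AddCommMonoid M] (F : ℕ → ℕ → M) (N h : ℕ) :
    ∑ i ∈ Finset.range N, ∑ j ∈ Finset.range N, (if i = j + h then F i j else 0)
      = ∑ j ∈ Finset.range (N - h), F (j + h) j := by
  rw [Finset.sum_comm]
  simp_rw [Finset.sum_ite_eq']
  rw [← Finset.sum_filter]
  refine Finset.sum_congr ?_ fun _ _ => rfl
  ext j
  simp only [Finset.mem_filter, Finset.mem_range]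
  omega

/-- The autocovariances of a moving average. -/
theorem crossGram_movingAverage {ζ : ℤ → Fin m → H} {S : Matrix (Fin m) (Fin m) ℝ}
    (hζ : ∀ s t, crossGram (ζ s) (ζ t) = if s = t then S else 0)
    (A : ℕ → Matrix (Fin l) (Fin m) ℝ) (p h : ℕ) (t : ℤ) :
    crossGram (∑ i ∈ Finset.range (p + 1), act (A i) (ζ (t + h - i)))
      (∑ i ∈ Finset.range (p + 1), act (A i) (ζ (t - i)))
      = ∑ i ∈ Finset.range (p + 1 - h), A (i + h) * S * (A i)ᵀ := by
  rw [crossGram_sum_left, ← sum_range_sum_range_lag fun i j => A i * S * (A j)ᵀ]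
  refine Finset.sum_congr rfl fun i _ => ?_
  rw [crossGram_sum_right]
  refine Finset.sum_congr rfl fun j _ => ?_
  rw [crossGram_act_left, crossGram_act_right, hζ]
  by_cases hij : i = j + h
  · rw [if_pos hij, if_pos (by omega), Matrix.mul_assoc]
  · rw [if_neg hij, if_neg (by omega), Matrix.zero_mul, Matrix.mul_zero]

theorem crossGram_movingAverage_noise {ζ : ℤ → Fin m → H} {S : Matrix (Fin m) (Fin m) ℝ}
    (hζ : ∀ s t, crossGram (ζ s) (ζ t) = if s = t then S else 0)
    (A : ℕ → Matrix (Fin l) (Fin m) ℝ) (p h : ℕ) (hp : h ≤ p) (t : ℤ) :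
    crossGram (∑ i ∈ Finset.range (p + 1), act (A i) (ζ (t + h - i))) (ζ t) = A h * S := by
  rw [crossGram_sum_left, Finset.sum_eq_single h]
  · rw [crossGram_act_left, hζ, if_pos (by omega)]
  · intro i _ hi
    rw [crossGram_act_left, hζ, if_neg (by omega), Matrix.mul_zero]
  · intro hh
    exact absurd (Finset.mem_range.2 (by omega)) hh

theorem crossGram_movingAverage_future {ζ : ℤ → Fin m → H} {S : Matrix (Fin m) (Fin m) ℝ}
    (hζ : ∀ s t, crossGram (ζ s) (ζ t) = if s = t then S else 0)
    (A : ℕ → Matrix (Fin l) (Fin m) ℝ) (p : ℕ) {s t : ℤ} (hst : s < t) :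
    crossGram (∑ i ∈ Finset.range (p + 1), act (A i) (ζ (s - i))) (ζ t) = 0 := by
  rw [crossGram_sum_left, Finset.sum_eq_zero]
  intro i _
  rw [crossGram_act_left, hζ, if_neg (by omega), Matrix.mul_zero]

theorem sum_Icc_eq_sum_range {M : Type*} [AddCommMonoid M] (F : ℕ → M) (p : ℕ) :
    F 0 + ∑ i ∈ Finset.Icc 1 p, F i = ∑ i ∈ Finset.range (p + 1), F i := by
  rw [Finset.sum_range_succ', add_comm, ← Finset.sum_image (g := fun i => i + 1) (f := F)
    fun _ _ _ _ h => Nat.succ_injective h]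
  congr 1
  refine Finset.sum_congr ?_ fun _ _ => rfl
  ext i
  simp only [Finset.mem_image, Finset.mem_range, Finset.mem_Icc]
  constructor
  · intro h; exact ⟨i - 1, by omega, by omega⟩
  · rintro ⟨j, hj, rfl⟩; omega

end MovingAverage

-- Symmetric solutions of the system are positive semidefinite.

section Positivity

variable {H : Type*} [NormedAddCommGroup H] [InnerProductSpace ℝ H] {m : ℕ}
  {Γ : ℤ → Matrix (Fin m) (Fin m) ℝ} {z : ℤ → Fin m → H} {p : ℕ}
  {S : Matrix (Fin m) (Fin m) ℝ} {Θ : ℕ → Matrix (Fin m) (Fin m) ℝ}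

/-- Truncated subtraction makes the sum empty for `h > p`, so one formula serves all lags. -/
theorem SolvesACVF.acvf_natCast (hs : SolvesACVF Γ p S Θ) (hp : ∀ h : ℕ, p < h → Γ h = 0)
    (h : ℕ) : Γ h = ∑ i ∈ Finset.range (p + 1 - h), Θ (i + h) * S * (Θ i)ᵀ := by
  rcases le_or_gt h p with hh | hh
  · rw [hs.eqs h hh, Nat.sub_add_comm hh]
  · rw [hp h hh, show p + 1 - h = 0 by omega, Finset.range_zero, Finset.sum_empty]

open Polynomial in
/-- The moving average polynomial `∑ Θ_i X ^ i` with matrix coefficients. -/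
def maPoly (p : ℕ) (Θ : ℕ → Matrix (Fin m) (Fin m) ℝ) : (Matrix (Fin m) (Fin m) ℝ)[X] :=
  ∑ i ∈ Finset.range (p + 1), Polynomial.monomial i (Θ i)

theorem maPoly_coeff (p : ℕ) (Θ : ℕ → Matrix (Fin m) (Fin m) ℝ) (i : ℕ) :
    (maPoly p Θ).coeff i = if i ≤ p then Θ i else 0 := by
  simp [maPoly, Polynomial.coeff_monomial]

/-- The coefficient at `s` of the moving average polynomial shifted by `j`. -/
def maShift (p : ℕ) (Θ : ℕ → Matrix (Fin m) (Fin m) ℝ) (j s : ℕ) : Matrix (Fin m) (Fin m) ℝ :=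
  if j ≤ s then (maPoly p Θ).coeff (s - j) else 0

/-- Formally `z_{-j} = ∑ maShift p Θ j s ζ_{-s}` with noise of covariance `S`, and this is the
covariance of `z_{-j}` with `z_{-k}`. As an algebraic identity it needs no such noise, nor
positivity of `S`. -/
theorem sum_maShift_of_le (hs : SolvesACVF Γ p S Θ) (hp : ∀ h : ℕ, p < h → Γ h = 0)
    {K j k : ℕ} (hjk : j ≤ k) (hK : k + p < K) :
    ∑ s ∈ Finset.range K, maShift p Θ j s * S * (maShift p Θ k s)ᵀ = Γ ((k : ℤ) - j) := by
  rw [show (k : ℤ) - j = ((k - j : ℕ) : ℤ) by omega, hs.acvf_natCast hp]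
  have h1 : ∑ s ∈ Finset.range K, maShift p Θ j s * S * (maShift p Θ k s)ᵀ
      = ∑ s ∈ (Finset.range (p + 1 - (k - j))).map (addLeftEmbedding k),
        maShift p Θ j s * S * (maShift p Θ k s)ᵀ := by
    refine (Finset.sum_subset ?_ fun s _ hs' => ?_).symm
    · intro s
      simp only [Finset.mem_map, Finset.mem_range, addLeftEmbedding_apply]
      rintro ⟨i, hi, rfl⟩
      omega
    · simp only [Finset.mem_map, Finset.mem_range, addLeftEmbedding_apply, not_exists,
        not_and] at hs'
      have hs'' := hs' (s - k)
      by_cases hks : k ≤ s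
      · rw [maShift, maPoly_coeff, if_pos (hjk.trans hks), if_neg (by omega), Matrix.zero_mul,
          Matrix.zero_mul]
      · rw [maShift, maShift, if_neg hks, Matrix.transpose_zero, Matrix.mul_zero]
  rw [h1, Finset.sum_map]
  refine Finset.sum_congr rfl fun i hi => ?_
  have hi := Finset.mem_range.1 hi
  rw [addLeftEmbedding_apply, maShift, maShift, maPoly_coeff, maPoly_coeff, if_pos (by omega),
    if_pos (by omega), if_pos (by omega), if_pos (by omega), show k + i - j = i + (k - j) by omega,
    Nat.add_sub_cancel_left]

theorem sum_maShift (hz : ∀ s t, crossGram (z s) (z t) = Γ (s - t)) (hs : SolvesACVF Γ p S Θ)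
    (hp : ∀ h : ℕ, p < h → Γ h = 0) {K j k : ℕ} (hj : j + p < K) (hk : k + p < K) :
    ∑ s ∈ Finset.range K, maShift p Θ j s * S * (maShift p Θ k s)ᵀ = Γ ((k : ℤ) - j) := by
  rcases le_total j k with h | h
  · exact sum_maShift_of_le hs hp h hk
  · have h1 := congrArg Matrix.transpose (sum_maShift_of_le hs hp h hj)
    have h2 : (Γ ((j : ℤ) - k))ᵀ = Γ ((k : ℤ) - j) := by
      rw [← hz, crossGram_transpose, hz]
    rw [h2, Matrix.transpose_sum] at h1
    rw [← h1]
    refine Finset.sum_congr rfl fun s _ => ?_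
    rw [Matrix.transpose_mul, Matrix.transpose_mul, Matrix.transpose_transpose, hs.symm.eq,
      Matrix.mul_assoc]

theorem sum_mul_maShift (p : ℕ) (Θ : ℕ → Matrix (Fin m) (Fin m) ℝ)
    (a : Polynomial (Matrix (Fin m) (Fin m) ℝ)) (s : ℕ) :
    ∑ j ∈ Finset.range (a.natDegree + 1), a.coeff j * maShift p Θ j s
      = (a * maPoly p Θ).coeff s := by
  rw [Polynomial.coeff_mul, Finset.Nat.sum_antidiagonal_eq_sum_range_succ_mk]
  have h1 : ∑ j ∈ Finset.range (s + 1), a.coeff j * (maPoly p Θ).coeff (s - j)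
      = ∑ j ∈ Finset.range (s + 1), a.coeff j * maShift p Θ j s := by
    refine Finset.sum_congr rfl fun j hj => ?_
    rw [maShift, if_pos (Nat.lt_succ_iff.1 (Finset.mem_range.1 hj))]
  rw [h1]
  trans ∑ j ∈ Finset.range (a.natDegree + 1 + (s + 1)), a.coeff j * maShift p Θ j s
  · refine Finset.sum_subset (Finset.range_subset_range.2 (by omega)) fun j _ hj => ?_
    rw [Finset.mem_range, not_lt] at hj
    rw [Polynomial.coeff_eq_zero_of_natDegree_lt (by omega), Matrix.zero_mul]
  · refine (Finset.sum_subset (Finset.range_subset_range.2 (by omega)) fun j _ hj => ?_).symm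
    rw [Finset.mem_range, not_lt] at hj
    rw [maShift, if_neg (by omega), Matrix.mul_zero]

/-- A symmetric covariance matrix that solves the moving average system of a stationary series is
positive semidefinite: multiplying by the adjugate of the moving average polynomial exhibits a
positive multiple of it as a Gram matrix. -/
theorem SolvesACVF.posSemidef (hz : ∀ s t, crossGram (z s) (z t) = Γ (s - t))
    (hs : SolvesACVF Γ p S Θ) (hp : ∀ h : ℕ, p < h → Γ h = 0) : S.PosSemidef := by
  -- A polynomial with matrix coefficients is read as a matrix over the commutative ring of real
  -- polynomials, where it has an adjugate.
  set Q := matPolyEquiv.symm (maPoly p Θ) with hQ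
  set a := matPolyEquiv Q.adjugate with ha
  have haM : ∀ s, (a * maPoly p Θ).coeff s = Q.det.coeff s • 1 := by
    intro s
    have e : a * maPoly p Θ = matPolyEquiv (Q.det • 1) := by
      rw [← Matrix.adjugate_mul, map_mul, ← ha, hQ, AlgEquiv.apply_symm_apply]
    rw [e]
    ext i j
    rw [matPolyEquiv_coeff_apply, Matrix.smul_apply, Matrix.smul_apply, Matrix.one_apply,
      Matrix.one_apply]
    split_ifs <;> simp
  -- At `0` the polynomial takes the value `Θ 0 = 1`, so its determinant is not the zero polynomial.
  have hdet0 : Q.det.coeff 0 = 1 := by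
    rw [Polynomial.coeff_zero_eq_eval_zero, _root_.eval_det, hQ, AlgEquiv.apply_symm_apply,
      map_zero, ← Polynomial.coeff_zero_eq_eval_zero, maPoly_coeff, if_pos (Nat.zero_le _),
      hs.theta_zero, Matrix.det_one]
  set N := a.natDegree + 1 with hN
  set K := N + p with hK
  -- The filter `a` applied to the series turns the coefficients `Θ` into the scalars `Q.det.coeff
  -- s`, which come out of the Gram matrix as squares.
  set x : Fin m → H := ∑ j ∈ Finset.range N, act (a.coeff j) (z (-(j : ℤ))) with hx
  have hxx : crossGram x x = (∑ s ∈ Finset.range K, Q.det.coeff s ^ 2) • S := by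
    calc crossGram x x
        = ∑ j ∈ Finset.range N, ∑ k ∈ Finset.range N,
            a.coeff j * Γ ((k : ℤ) - j) * (a.coeff k)ᵀ := by
          rw [hx, crossGram_sum_left]
          refine Finset.sum_congr rfl fun j _ => ?_
          rw [crossGram_sum_right]
          refine Finset.sum_congr rfl fun k _ => ?_
          rw [crossGram_act_left, crossGram_act_right, hz, Matrix.mul_assoc,
            show -(j : ℤ) - -k = k - j by ring]
      _ = ∑ j ∈ Finset.range N, ∑ k ∈ Finset.range N, ∑ s ∈ Finset.range K,
            (a.coeff j * maShift p Θ j s) * S * (a.coeff k * maShift p Θ k s)ᵀ := by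
          refine Finset.sum_congr rfl fun j hj => Finset.sum_congr rfl fun k hk => ?_
          rw [Finset.mem_range] at hj hk
          rw [← sum_maShift hz hs hp (K := K) (by omega) (by omega), Finset.mul_sum,
            Finset.sum_mul]
          refine Finset.sum_congr rfl fun s _ => ?_
          simp only [Matrix.transpose_mul, Matrix.mul_assoc]
      _ = ∑ s ∈ Finset.range K, (∑ j ∈ Finset.range N, a.coeff j * maShift p Θ j s) * S
            * (∑ k ∈ Finset.range N, a.coeff k * maShift p Θ k s)ᵀ := by
          simp_rw [Finset.sum_comm (s := Finset.range N) (t := Finset.range K)]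
          refine Finset.sum_congr rfl fun s _ => ?_
          rw [Finset.sum_mul, Finset.sum_mul]
          refine Finset.sum_congr rfl fun j _ => ?_
          rw [Matrix.transpose_sum, Finset.mul_sum]
      _ = (∑ s ∈ Finset.range K, Q.det.coeff s ^ 2) • S := by
          rw [Finset.sum_smul]
          refine Finset.sum_congr rfl fun s _ => ?_
          rw [sum_mul_maShift, haM, Matrix.transpose_smul, Matrix.transpose_one, smul_mul_assoc,
            Matrix.one_mul, mul_smul_comm, Matrix.mul_one, smul_smul, sq]
  have hpos : 0 < ∑ s ∈ Finset.range K, Q.det.coeff s ^ 2 := by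
    refine Finset.sum_pos' (fun s _ => sq_nonneg _) ⟨0, Finset.mem_range.2 (by omega), ?_⟩
    rw [hdet0]
    norm_num
  have h := (crossGram_posSemidef x).smul (inv_nonneg.2 hpos.le)
  rwa [hxx, smul_smul, inv_mul_cancel₀ hpos.ne', one_smul] at h

end Positivity

-- Maximality and uniqueness of the limiting solution.

section Maximality

variable {m : ℕ}

/-- The standard orthonormal family of `ℓ²` indexed by time and coordinate; the raw material for
models of competing solutions. -/
theorem exists_whiteNoise (m : ℕ) : ∃ b : ℤ → Fin m → lp (fun _ : ℤ × Fin m => ℝ) 2,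
    ∀ s t, crossGram (b s) (b t) = if s = t then 1 else 0 := by
  classical
  refine ⟨fun t i => lp.single 2 (t, i) 1, fun s t => ?_⟩
  ext i j
  rw [crossGram_apply, lp.inner_single_left, lp.single_apply]
  by_cases hst : s = t
  · subst hst
    by_cases hij : i = j
    · subst hij; simp
    · simp [hij]
  · simp [hst]

/-- Every solution of the moving average system is realised by a moving average in `ℓ²`. -/
theorem SolvesACVF.exists_model {Γ : ℤ → Matrix (Fin m) (Fin m) ℝ} {p : ℕ}
    {S : Matrix (Fin m) (Fin m) ℝ} {Θ : ℕ → Matrix (Fin m) (Fin m) ℝ}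
    (hs : SolvesACVF Γ p S Θ) (hp : ∀ h : ℕ, p < h → Γ h = 0) (hΓ : ∀ h, (Γ h)ᵀ = Γ (-h))
    (hS : S.PosSemidef) :
    ∃ ζ x : ℤ → Fin m → lp (fun _ : ℤ × Fin m => ℝ) 2,
      (∀ s t, crossGram (x s) (x t) = Γ (s - t)) ∧
      (∀ s t, crossGram (ζ s) (ζ t) = if s = t then S else 0) ∧
      (∀ s t, s < t → crossGram (x s) (ζ t) = 0) ∧
      ∀ h : ℕ, h ≤ p → ∀ t, crossGram (x (t + h)) (ζ t) = Θ h * S := by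
  obtain ⟨b, hb⟩ := exists_whiteNoise m
  -- A square root turns standard noise `b` into noise `Rᵀ b` of covariance `S`; this is where
  -- positivity of `S` is needed.
  obtain ⟨R, hR⟩ : ∃ R : Matrix (Fin m) (Fin m) ℝ, S = Rᵀ * R := by
    open scoped MatrixOrder in
    obtain ⟨R, hR⟩ := CStarAlgebra.nonneg_iff_eq_star_mul_self.1 hS.nonneg
    exact ⟨R, by
      rwa [Matrix.star_eq_conjTranspose, Matrix.conjTranspose_eq_transpose_of_trivial] at hR⟩
  have hζ : ∀ s t, crossGram (act Rᵀ (b s)) (act Rᵀ (b t)) = if s = t then S else 0 := by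
    intro s t
    rw [crossGram_act_left, crossGram_act_right, hb, Matrix.transpose_transpose]
    split_ifs
    · rw [Matrix.one_mul, hR]
    · rw [Matrix.zero_mul, Matrix.mul_zero]
  set ζ : ℤ → Fin m → lp (fun _ : ℤ × Fin m => ℝ) 2 := fun t => act Rᵀ (b t) with hζdef
  refine ⟨ζ, fun t => ∑ i ∈ Finset.range (p + 1), act (Θ i) (ζ (t - i)), ?_, hζ, ?_, ?_⟩
  · have hle : ∀ (t : ℤ) (h : ℕ),
        crossGram (∑ i ∈ Finset.range (p + 1), act (Θ i) (ζ (t + h - i)))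
          (∑ i ∈ Finset.range (p + 1), act (Θ i) (ζ (t - i))) = Γ h := by
      intro t h
      rw [crossGram_movingAverage hζ, hs.acvf_natCast hp]
    intro s t
    rcases le_total t s with hst | hst
    · obtain ⟨k, rfl⟩ := Int.le.dest hst
      rw [add_sub_cancel_left]
      exact hle t k
    · obtain ⟨k, rfl⟩ := Int.le.dest hst
      rw [← crossGram_transpose, hle s k, hΓ]
      congr 1
      ring
  · intro s t hst
    exact crossGram_movingAverage_future hζ Θ p hst
  · intro h hh t
    exact crossGram_movingAverage_noise hζ Θ p h hh t

/-- `innovSigma` and `innovTheta` depend on `Γ` alone, so they may be interpreted in the `ℓ²` model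
of a rival solution, whose noise is orthogonal to the past. -/
theorem isMaximalSolution_of_tendsto {H : Type*} [NormedAddCommGroup H] [InnerProductSpace ℝ H]
    {z : ℤ → Fin m → H} {Γ : ℤ → Matrix (Fin m) (Fin m) ℝ} {p : ℕ}
    {S : Matrix (Fin m) (Fin m) ℝ} {Θ : ℕ → Matrix (Fin m) (Fin m) ℝ}
    (hz : ∀ s t, crossGram (z s) (z t) = Γ (s - t)) (hu : ∀ n, IsUnit (innovSigma Γ n).det)
    (hp : ∀ h : ℕ, p < h → Γ h = 0)
    (hS : Tendsto (fun n => innovSigma Γ n) atTop (𝓝 S)) (hSu : IsUnit S.det)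
    (hΘ : ∀ i, 1 ≤ i → i ≤ p → Tendsto (fun n => innovTheta Γ n i) atTop (𝓝 (Θ i)))
    (hs : SolvesACVF Γ p S Θ) : IsMaximalSolution Γ p S Θ := by
  have hΓ : ∀ h, (Γ h)ᵀ = Γ (-h) := by
    intro h
    have h1 := hz h 0
    rw [sub_zero] at h1
    rw [← h1, crossGram_transpose, hz, zero_sub]
  refine ⟨hs, fun S' Θ' hs' => ?_, fun Θ' hs' i hi hip => ?_⟩
  · obtain ⟨ζ, x, hx, hζ, hpast, hnoise⟩ := hs'.exists_model hp hΓ (hs'.posSemidef hz hp)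
    refine posSemidef_of_tendsto (hS.sub_const S') fun n => ?_
    rw [← crossGram_innov_sub hx (-n) (fun k _ => hu k) (fun j hj => hpast _ 0 (by omega))
      (by simpa [hs'.theta_zero] using hnoise 0 (Nat.zero_le _) 0) (by rw [hζ, if_pos rfl])]
    exact crossGram_posSemidef _
  · obtain ⟨ζ, x, hx, hζ, hpast, hnoise⟩ := hs'.exists_model hp hΓ (hs'.posSemidef hz hp)
    -- The error minus the noise of the model has Gram matrix `Σ_n - S`, which now tends to `0`.
    have hlim : Tendsto (fun n : ℕ => innov Γ x (0 - n) n) atTop (𝓝 (ζ 0)) := by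
      refine tendsto_pi_nhds.2 fun j => ?_
      rw [tendsto_iff_norm_sub_tendsto_zero]
      have hsq : Tendsto (fun n : ℕ => ‖innov Γ x (0 - n) n j - ζ 0 j‖ ^ 2) atTop (𝓝 0) := by
        have h := tendsto_pi_nhds.1 (tendsto_pi_nhds.1 (hS.sub_const S) j) j
        rw [sub_self] at h
        refine h.congr fun n => ?_
        rw [← crossGram_innov_sub hx (0 - n) (fun k _ => hu k)
          (fun i hi => hpast _ 0 (by omega))
          (by simpa [hs'.theta_zero] using hnoise 0 (Nat.zero_le _) 0) (by rw [hζ, if_pos rfl])]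
        rw [crossGram_apply, real_inner_self_eq_norm_sq]
        rfl
      have h := hsq.sqrt
      rw [Real.sqrt_zero] at h
      exact h.congr fun n => Real.sqrt_sq (norm_nonneg _)
    have h1 := tendsto_crossGram (tendsto_const_nhds (x := x (0 + i))) hlim
    rw [hnoise i hip] at h1
    -- `Θ_{n+i,i} Σ_n` has the two limits `Θ i * S` and `Θ' i * S`; then `S` is cancelled.
    have h2 := ((tendsto_add_atTop_iff_nat i).2 (hΘ i hi hip)).mul hS
    have h3 := tendsto_nhds_unique h2
      (h1.congr fun n => (innovTheta_add_mul_innovSigma hx hu 0 n hi).symm)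
    rw [← Matrix.mul_nonsing_inv_cancel_right S (Θ' i) hSu, ← h3,
      Matrix.mul_nonsing_inv_cancel_right S (Θ i) hSu]

/-- The limit theorem for the innovations algorithm of a stationary series whose autocovariances
vanish after lag `p` and which has a nondegenerate component uncorrelated with the past. -/
theorem exists_movingAverage {H : Type*} [NormedAddCommGroup H] [InnerProductSpace ℝ H]
    [CompleteSpace H] {z : ℤ → Fin m → H} {Γ : ℤ → Matrix (Fin m) (Fin m) ℝ} {p : ℕ}
    (hz : ∀ s t, crossGram (z s) (z t) = Γ (s - t)) (hp : ∀ h : ℕ, p < h → Γ h = 0)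
    (hone : ∀ n, (innovSigma Γ n - 1).PosSemidef) :
    ∃ (S : Matrix (Fin m) (Fin m) ℝ) (Θ : ℕ → Matrix (Fin m) (Fin m) ℝ) (ζ : ℤ → Fin m → H),
      (S - 1).PosSemidef ∧ Tendsto (fun n => innovSigma Γ n) atTop (𝓝 S) ∧
      (∀ i, 1 ≤ i → Tendsto (fun n => innovTheta Γ n i) atTop (𝓝 (Θ i))) ∧
      IsMaximalSolution Γ p S Θ ∧
      (∀ s t, crossGram (ζ s) (ζ t) = if s = t then S else 0) ∧
      (∀ t, z t = ζ t + ∑ i ∈ Finset.Icc 1 p, act (Θ i) (ζ (t - i))) ∧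
      ∀ v : H, (∀ t i, inner ℝ v (z t i) = 0) → ∀ t i, inner ℝ v (ζ t i) = 0 := by
  have hu : ∀ n, IsUnit (innovSigma Γ n).det := fun n =>
    isUnit_det_of_posDef (posDef_of_sub_one (hone n))
  choose ζ hζ using exists_tendsto_innov hz hu
  set S := crossGram (ζ 0) (ζ 0) with hSdef
  have hS : Tendsto (fun n => innovSigma Γ n) atTop (𝓝 S) :=
    (tendsto_crossGram (hζ 0) (hζ 0)).congr fun n : ℕ =>
      (crossGram_innov hz (0 - n) n fun k _ => hu k).2
  have hS1 : (S - 1).PosSemidef := posSemidef_of_tendsto (hS.sub_const 1) hone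
  have hSu : IsUnit S.det := isUnit_det_of_posDef (posDef_of_sub_one hS1)
  -- Index `0` is set by hand, because `innovTheta Γ n 0` is the default value `0` and not the
  -- identity.
  set Θ : ℕ → Matrix (Fin m) (Fin m) ℝ :=
    fun i => if i = 0 then 1 else crossGram (z i) (ζ 0) * S⁻¹ with hΘdef
  have hΘ : ∀ i, 1 ≤ i → Tendsto (fun n => innovTheta Γ n i) atTop (𝓝 (Θ i)) := by
    intro i hi
    simp only [hΘdef, if_neg (by omega : i ≠ 0)]
    exact tendsto_innovTheta hz hu hζ hS hSu hi
  have hwn := crossGram_limit hz hu hζ hS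
  have hrep := series_eq_limit_add hz hu hp hζ hΘ
  have hsol : SolvesACVF Γ p S Θ := by
    refine ⟨crossGram_transpose _ _, if_pos rfl, fun h hh => ?_⟩
    have hrep' : ∀ t, z t = ∑ i ∈ Finset.range (p + 1), act (Θ i) (ζ (t - i)) := by
      intro t
      rw [hrep t, ← sum_Icc_eq_sum_range fun i => act (Θ i) (ζ (t - i))]
      congr 1
      simp [hΘdef, act_one]
    have h1 := crossGram_movingAverage hwn Θ p h 0
    rw [← hrep', ← hrep', hz, Nat.sub_add_comm hh] at h1
    rw [← h1]
    congr 1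
    ring
  exact ⟨S, Θ, ζ, hS1, hS, hΘ,
    isMaximalSolution_of_tendsto hz hu hp hS hSu (fun i hi _ => hΘ i hi) hsol, hwn, hrep,
    fun v hv => inner_limit_eq_zero hv hζ⟩

end Maximality

-- Compatibility of the algorithm with orthonormal embeddings.

section Reduction

variable {d r : ℕ} {Q : Matrix (Fin d) (Fin r) ℝ}

/-- The extension of an `r × r` matrix by the identity on the orthogonal complement of the column
space of `Q`. -/
def lift (Q : Matrix (Fin d) (Fin r) ℝ) (A : Matrix (Fin r) (Fin r) ℝ) :
    Matrix (Fin d) (Fin d) ℝ :=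
  1 - Q * Qᵀ + Q * A * Qᵀ

/-- `lift Q A` is block diagonal: `A` on the range of `Q`, the identity on its complement. -/
theorem lift_mul_lift (hQ : Qᵀ * Q = 1) (A B : Matrix (Fin r) (Fin r) ℝ) :
    lift Q A * lift Q B = lift Q (A * B) := by
  have h1 : Q * Qᵀ * (Q * Qᵀ) = Q * Qᵀ := by
    rw [Matrix.mul_assoc, ← Matrix.mul_assoc Qᵀ, hQ, Matrix.one_mul]
  have h2 : Q * Qᵀ * (Q * B * Qᵀ) = Q * B * Qᵀ := by
    rw [Matrix.mul_assoc, Matrix.mul_assoc Q B, ← Matrix.mul_assoc Qᵀ Q, hQ, Matrix.one_mul]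
  have h3 : Q * A * Qᵀ * (Q * Qᵀ) = Q * A * Qᵀ := by
    rw [Matrix.mul_assoc, ← Matrix.mul_assoc Qᵀ, hQ, Matrix.one_mul]
  have h4 : Q * A * Qᵀ * (Q * B * Qᵀ) = Q * (A * B) * Qᵀ := by
    rw [Matrix.mul_assoc (Q * A), Matrix.mul_assoc Q B, ← Matrix.mul_assoc Qᵀ Q, hQ,
      Matrix.one_mul, Matrix.mul_assoc Q A, Matrix.mul_assoc Q (A * B), Matrix.mul_assoc A B]
  simp only [lift, Matrix.add_mul, Matrix.mul_add, Matrix.sub_mul, Matrix.mul_sub, Matrix.one_mul,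
    Matrix.mul_one, h1, h2, h3, h4]
  abel

theorem lift_one (Q : Matrix (Fin d) (Fin r) ℝ) : lift Q 1 = 1 := by
  simp [lift]

theorem lift_inv (hQ : Qᵀ * Q = 1) {A : Matrix (Fin r) (Fin r) ℝ} (hA : IsUnit A.det) :
    (lift Q A)⁻¹ = lift Q A⁻¹ := by
  refine Matrix.inv_eq_right_inv ?_
  rw [lift_mul_lift hQ, Matrix.mul_nonsing_inv _ hA, lift_one]

theorem mul_lift (hQ : Qᵀ * Q = 1) (A B : Matrix (Fin r) (Fin r) ℝ) :
    Q * A * Qᵀ * lift Q B = Q * (A * B) * Qᵀ := by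
  have h3 : Q * A * Qᵀ * (Q * Qᵀ) = Q * A * Qᵀ := by
    rw [Matrix.mul_assoc, ← Matrix.mul_assoc Qᵀ, hQ, Matrix.one_mul]
  have h4 : Q * A * Qᵀ * (Q * B * Qᵀ) = Q * (A * B) * Qᵀ := by
    rw [Matrix.mul_assoc (Q * A), Matrix.mul_assoc Q B, ← Matrix.mul_assoc Qᵀ Q, hQ,
      Matrix.one_mul, Matrix.mul_assoc Q A, Matrix.mul_assoc Q (A * B), Matrix.mul_assoc A B]
  rw [lift, Matrix.mul_add, Matrix.mul_sub, Matrix.mul_one, h3, h4, sub_self, zero_add]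

/-- The shape of each summand in the recursions; the identity block of the lift is annihilated. -/
theorem conj_mul_lift_mul_conj (hQ : Qᵀ * Q = 1) (A B C : Matrix (Fin r) (Fin r) ℝ) :
    Q * A * Qᵀ * lift Q B * (Q * C * Qᵀ)ᵀ = Q * (A * B * Cᵀ) * Qᵀ := by
  rw [mul_lift hQ, Matrix.transpose_mul, Matrix.transpose_mul, Matrix.transpose_transpose,
    Matrix.mul_assoc (Q * (A * B)), ← Matrix.mul_assoc Qᵀ, hQ, Matrix.one_mul]
  simp only [Matrix.mul_assoc]

theorem continuous_conj (Q : Matrix (Fin d) (Fin r) ℝ) :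
    Continuous fun A : Matrix (Fin r) (Fin r) ℝ => Q * A * Qᵀ :=
  (continuous_const.matrix_mul continuous_id).matrix_mul continuous_const

theorem continuous_lift (Q : Matrix (Fin d) (Fin r) ℝ) : Continuous (lift Q) :=
  continuous_const.add (continuous_conj Q)

variable {ΓZ : ℤ → Matrix (Fin d) (Fin d) ℝ} {ΓW : ℤ → Matrix (Fin r) (Fin r) ℝ}

/-- The innovations algorithm is compatible with the reduction of dimension. -/
theorem innov_lift (hQ : Qᵀ * Q = 1) (h0 : ΓZ 0 = lift Q (ΓW 0))
    (hΓ : ∀ h : ℕ, 1 ≤ h → ΓZ h = Q * ΓW h * Qᵀ) (hu : ∀ n, IsUnit (innovSigma ΓW n).det)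
    (n : ℕ) :
    (∀ k < n, innovCoef ΓZ n k = Q * innovCoef ΓW n k * Qᵀ) ∧
      innovSigma ΓZ n = lift Q (innovSigma ΓW n) := by
  induction n using Nat.strong_induction_on with
  | _ n ih =>
    -- An inner induction on `k` is needed because the coefficient at `k` uses those at `j < k` of
    -- the same stage `n`.
    have hcoef : ∀ k < n, innovCoef ΓZ n k = Q * innovCoef ΓW n k * Qᵀ := by
      intro k
      induction k using Nat.strong_induction_on with
      | _ k ihk =>
        intro hk
        have hsum : ∑ j ∈ Finset.range k, innovCoef ΓZ n j * innovSigma ΓZ j * (innovCoef ΓZ k j)ᵀ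
            = Q * (∑ j ∈ Finset.range k,
              innovCoef ΓW n j * innovSigma ΓW j * (innovCoef ΓW k j)ᵀ) * Qᵀ := by
          rw [Matrix.mul_sum, Matrix.sum_mul]
          refine Finset.sum_congr rfl fun j hj => ?_
          have hj := Finset.mem_range.1 hj
          rw [ihk j hj (hj.trans hk), (ih j (hj.trans hk)).2, (ih k hk).1 j hj,
            conj_mul_lift_mul_conj hQ]
        rw [innovCoef_eq ΓZ hk, innovCoef_eq ΓW hk, hsum, (ih k hk).2, lift_inv hQ (hu k),
          show (n : ℤ) - k = ((n - k : ℕ) : ℤ) by omega, hΓ _ (by omega), ← Matrix.sub_mul,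
          ← Matrix.mul_sub, mul_lift hQ]
    refine ⟨hcoef, ?_⟩
    have hsum : ∑ j ∈ Finset.range n, innovCoef ΓZ n j * innovSigma ΓZ j * (innovCoef ΓZ n j)ᵀ
        = Q * (∑ j ∈ Finset.range n,
          innovCoef ΓW n j * innovSigma ΓW j * (innovCoef ΓW n j)ᵀ) * Qᵀ := by
      rw [Matrix.mul_sum, Matrix.sum_mul]
      refine Finset.sum_congr rfl fun j hj => ?_
      have hj := Finset.mem_range.1 hj
      rw [hcoef j hj, (ih j hj).2, conj_mul_lift_mul_conj hQ]
    rw [innovSigma_eq, innovSigma_eq, h0, hsum, lift, lift, Matrix.mul_sub, Matrix.sub_mul]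
    abel

theorem innovTheta_lift (hQ : Qᵀ * Q = 1) (h0 : ΓZ 0 = lift Q (ΓW 0))
    (hΓ : ∀ h : ℕ, 1 ≤ h → ΓZ h = Q * ΓW h * Qᵀ) (hu : ∀ n, IsUnit (innovSigma ΓW n).det)
    (n : ℕ) {i : ℕ} (hi : 1 ≤ i) : innovTheta ΓZ n i = Q * innovTheta ΓW n i * Qᵀ := by
  rw [innovTheta, innovTheta]
  split_ifs with h
  · exact (innov_lift hQ h0 hΓ hu n).1 _ (by omega)
  · simp

end Reduction

-- Passage between random vectors and tuples in `L²`.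

section Representation

variable {Ω : Type*} [MeasurableSpace Ω] {P : Measure Ω} {m n : ℕ}

/-- The random vector `Y` is represented by the tuple `y` of elements of `L²`. -/
def Represents (Y : Ω → Fin m → ℝ) (y : Fin m → Lp ℝ 2 P) : Prop :=
  ∀ i, (y i : Ω → ℝ) =ᵐ[P] fun ω => Y ω i

theorem coeFn_finsetSum {ι : Type*} (s : Finset ι) (g : ι → Lp ℝ 2 P) :
    ((∑ k ∈ s, g k : Lp ℝ 2 P) : Ω → ℝ) =ᵐ[P] fun ω => ∑ k ∈ s, g k ω := by
  classical
  induction s using Finset.induction_on with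
  | empty => simpa using! Lp.coeFn_zero ℝ 2 P
  | insert a s ha ih =>
    rw [Finset.sum_insert ha]
    filter_upwards [Lp.coeFn_add (g a) (∑ k ∈ s, g k), ih] with ω h1 h2
    rw [h1, Pi.add_apply, h2, Finset.sum_insert ha]

namespace Represents

variable {Y Y' : Ω → Fin m → ℝ} {y y' : Fin m → Lp ℝ 2 P}

theorem mulVec (h : Represents Y y) (A : Matrix (Fin n) (Fin m) ℝ) :
    Represents (fun ω => A *ᵥ Y ω) (act A y) := by
  intro i
  filter_upwards [coeFn_finsetSum Finset.univ (fun j => A i j • y j),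
    ae_all_iff.2 fun j => Lp.coeFn_smul (A i j) (y j), ae_all_iff.2 h] with ω h1 h2 h3
  rw [act, h1]
  simp [Matrix.mulVec, dotProduct, h2, h3]

theorem add (h : Represents Y y) (h' : Represents Y' y') :
    Represents (fun ω => Y ω + Y' ω) (y + y') := by
  intro i
  filter_upwards [Lp.coeFn_add (y i) (y' i), h i, h' i] with ω h1 h2 h3
  rw [Pi.add_apply, h1, Pi.add_apply, h2, h3, Pi.add_apply]

theorem sub (h : Represents Y y) (h' : Represents Y' y') :
    Represents (fun ω => Y ω - Y' ω) (y - y') := by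
  intro i
  filter_upwards [Lp.coeFn_sub (y i) (y' i), h i, h' i] with ω h1 h2 h3
  rw [Pi.sub_apply, h1, Pi.sub_apply, h2, h3, Pi.sub_apply]

theorem sum {ι : Type*} (s : Finset ι) {Y : ι → Ω → Fin m → ℝ} {y : ι → Fin m → Lp ℝ 2 P}
    (h : ∀ k, Represents (Y k) (y k)) :
    Represents (fun ω => ∑ k ∈ s, Y k ω) (∑ k ∈ s, y k) := by
  intro i
  have h' : ∀ᵐ ω ∂P, ∀ k ∈ s, y k i ω = Y k ω i :=
    (Filter.eventually_all_finset s).2 fun k _ => h k i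
  filter_upwards [coeFn_finsetSum s (fun k => y k i), h'] with ω h1 h2
  rw [Finset.sum_apply, h1, Finset.sum_apply]
  exact Finset.sum_congr rfl h2

theorem congr (h : Represents Y y) (h' : ∀ᵐ ω ∂P, Y ω = Y' ω) : Represents Y' y := by
  intro i
  filter_upwards [h i, h'] with ω h1 h2
  rw [h1, h2]

theorem ae_eq (h : Represents Y y) (h' : Represents Y' y) : ∀ᵐ ω ∂P, Y ω = Y' ω := by
  filter_upwards [ae_all_iff.2 h, ae_all_iff.2 h'] with ω h1 h2
  ext i
  rw [← h1, h2]

theorem eq (h : Represents Y y) (h' : Represents Y y') : y = y' := by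
  ext1 i
  exact Lp.ext ((h i).trans (h' i).symm)

theorem crossMoment_eq {W : Ω → Fin n → ℝ} {w : Fin n → Lp ℝ 2 P} (h : Represents Y y)
    (h' : Represents W w) : crossMoment P Y W = crossGram y w := by
  ext i j
  rw [crossGram_apply, L2.inner_def]
  refine integral_congr_ae ?_
  filter_upwards [h i, h' j] with ω h1 h2
  rw [h1, h2]
  simp [mul_comm]

theorem memLp (h : Represents Y y) (i : Fin m) : MemLp (fun ω => Y ω i) 2 P :=
  (Lp.memLp (y i)).ae_eq (h i)

/-- Turns zero mean into orthogonality to the constant `1`, which passes to linear combinations and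
limits. -/
theorem integral_eq [IsFiniteMeasure P] (h : Represents Y y) (i : Fin m) :
    ∫ ω, Y ω i ∂P = inner ℝ (Lp.const 2 P (1 : ℝ)) (y i) := by
  rw [L2.inner_def]
  refine integral_congr_ae ?_
  filter_upwards [h i, Lp.coeFn_const 2 P (1 : ℝ)] with ω h1 h2
  rw [h1, h2]
  simp

end Represents

/-- The elements of `L²` representing a square integrable random vector. -/
def repr (Y : Ω → Fin m → ℝ) (h : ∀ i, MemLp (fun ω => Y ω i) 2 P) : Fin m → Lp ℝ 2 P :=
  fun i => (h i).toLp

theorem represents_repr (Y : Ω → Fin m → ℝ) (h : ∀ i, MemLp (fun ω => Y ω i) 2 P) :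
    Represents Y (repr Y h) := fun i => (h i).coeFn_toLp

theorem represents_coeFn (y : Fin m → Lp ℝ 2 P) : Represents (fun ω i => y i ω) y :=
  fun _ => Filter.EventuallyEq.rfl

end Representation

-- The series `Z` and its autocovariances.

section FactorModel

variable {H : Type*} [NormedAddCommGroup H] [InnerProductSpace ℝ H] {d r : ℕ}

/-- The moving average coefficients `I, -Φ̃_1, -Φ̃_2, …`. -/
def arCoef (L : Matrix (Fin d) (Fin r) ℝ) (Φ : ℕ → Matrix (Fin r) (Fin r) ℝ) (i : ℕ) :
    Matrix (Fin d) (Fin d) ℝ :=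
  if i = 0 then 1 else -phiTilde L Φ i

theorem arCoef_zero (L : Matrix (Fin d) (Fin r) ℝ) (Φ : ℕ → Matrix (Fin r) (Fin r) ℝ) :
    arCoef L Φ 0 = 1 := if_pos rfl

theorem arCoef_of_pos (L : Matrix (Fin d) (Fin r) ℝ) (Φ : ℕ → Matrix (Fin r) (Fin r) ℝ) {i : ℕ}
    (hi : 1 ≤ i) : arCoef L Φ i = -phiTilde L Φ i := if_neg (by omega)

/-- The series `L η_t + ε_t - ∑ Φ̃_i ε_{t-i}` in a Hilbert space. -/
def zVec (p : ℕ) (L : Matrix (Fin d) (Fin r) ℝ) (Φ : ℕ → Matrix (Fin r) (Fin r) ℝ)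
    (e : ℤ → Fin d → H) (n : ℤ → Fin r → H) (t : ℤ) : Fin d → H :=
  act L (n t) + ∑ i ∈ Finset.range (p + 1), act (arCoef L Φ i) (e (t - i))

/-- The autocovariance of `zVec` at lag `h ≥ 0`. -/
def zCov (p : ℕ) (L : Matrix (Fin d) (Fin r) ℝ) (Φ : ℕ → Matrix (Fin r) (Fin r) ℝ)
    (Sη : Matrix (Fin r) (Fin r) ℝ) (h : ℕ) : Matrix (Fin d) (Fin d) ℝ :=
  (if h = 0 then L * Sη * Lᵀ else 0)
    + ∑ i ∈ Finset.range (p + 1 - h), arCoef L Φ (i + h) * (arCoef L Φ i)ᵀ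

variable {p : ℕ} {L : Matrix (Fin d) (Fin r) ℝ} {Φ : ℕ → Matrix (Fin r) (Fin r) ℝ}
  {Sη : Matrix (Fin r) (Fin r) ℝ} {e : ℤ → Fin d → H} {n : ℤ → Fin r → H}

theorem zVec_eq (t : ℤ) : zVec p L Φ e n t
    = act L (n t) + e t - ∑ i ∈ Finset.Icc 1 p, act (phiTilde L Φ i) (e (t - i)) := by
  have h : ∑ i ∈ Finset.Icc 1 p, act (arCoef L Φ i) (e (t - i))
      = -∑ i ∈ Finset.Icc 1 p, act (phiTilde L Φ i) (e (t - i)) := by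
    rw [← Finset.sum_neg_distrib]
    refine Finset.sum_congr rfl fun i hi => ?_
    rw [arCoef_of_pos L Φ (Finset.mem_Icc.1 hi).1, act_neg]
  rw [zVec, ← sum_Icc_eq_sum_range fun i => act (arCoef L Φ i) (e (t - i)), h, arCoef_zero,
    act_one, Nat.cast_zero, sub_zero]
  abel

theorem crossGram_zVec (he : ∀ s t, crossGram (e s) (e t) = if s = t then 1 else 0)
    (hn : ∀ s t, crossGram (n s) (n t) = if s = t then Sη else 0)
    (hen : ∀ s t, crossGram (e s) (n t) = 0) (t : ℤ) (h : ℕ) :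
    crossGram (zVec p L Φ e n (t + h)) (zVec p L Φ e n t) = zCov p L Φ Sη h := by
  have hma := crossGram_movingAverage he (arCoef L Φ) p h t
  have h1 : ∀ s u : ℤ, crossGram (∑ i ∈ Finset.range (p + 1), act (arCoef L Φ i) (e (s - i)))
      (act L (n u)) = 0 := by
    intro s u
    rw [crossGram_sum_left, Finset.sum_eq_zero]
    intro i _
    rw [crossGram_act_left, crossGram_act_right, hen, Matrix.zero_mul, Matrix.mul_zero]
  have h2 := congrArg Matrix.transpose (h1 t (t + h))
  rw [crossGram_transpose, Matrix.transpose_zero] at h2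
  rw [zCov, zVec, zVec, crossGram_add_left, crossGram_add_right, crossGram_add_right, h1, h2, hma,
    crossGram_act_left, crossGram_act_right, hn, add_zero, zero_add]
  congr 1
  · by_cases h0 : h = 0
    · rw [if_pos h0, if_pos (by omega), Matrix.mul_assoc]
    · rw [if_neg h0, if_neg (by omega), Matrix.zero_mul, Matrix.mul_zero]
  · simp_rw [Matrix.mul_one]

/-- Provides the vector `w` of `innovSigma_sub_one_posSemidef`. -/
theorem crossGram_zVec_error (he : ∀ s t, crossGram (e s) (e t) = if s = t then 1 else 0)
    (hen : ∀ s t, crossGram (e s) (n t) = 0) (t : ℤ) :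
    (∀ s < t, crossGram (zVec p L Φ e n s) (e t) = 0) ∧
      crossGram (zVec p L Φ e n t) (e t) = 1 := by
  have h0 : ∀ s, crossGram (act L (n s)) (e t) = 0 := by
    intro s
    rw [crossGram_act_left, ← crossGram_transpose, hen, Matrix.transpose_zero, Matrix.mul_zero]
  constructor
  · intro s hst
    rw [zVec, crossGram_add_left, h0, crossGram_movingAverage_future he _ p hst, add_zero]
  · have h1 := crossGram_movingAverage_noise he (arCoef L Φ) p 0 (Nat.zero_le _) t
    rw [Nat.cast_zero, add_zero] at h1
    rw [zVec, crossGram_add_left, h0, h1, arCoef_zero, zero_add, Matrix.one_mul]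

/-- Negative lags follow from nonnegative ones by transposition. -/
theorem crossGram_eq_of_natCast {m : ℕ} {z : ℤ → Fin m → H} {G : ℕ → Matrix (Fin m) (Fin m) ℝ}
    (hz : ∀ (t : ℤ) (h : ℕ), crossGram (z (t + h)) (z t) = G h) (s t : ℤ) :
    crossGram (z s) (z t) = crossGram (z (s - t)) (z 0) := by
  rcases le_total t s with h | h
  · obtain ⟨k, rfl⟩ := Int.le.dest h
    have h0 := hz 0 k
    rw [zero_add] at h0
    rw [hz, add_sub_cancel_left, h0]
  · obtain ⟨k, rfl⟩ := Int.le.dest h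
    have h0 := hz (s - (s + k)) k
    rw [show s - (s + k) + (k : ℤ) = 0 by ring] at h0
    rw [← crossGram_transpose, hz, ← h0, crossGram_transpose]

theorem zCov_zero : zCov p L Φ Sη 0 = L * Sη * Lᵀ + 1
    + ∑ i ∈ Finset.Icc 1 p, phiTilde L Φ i * (phiTilde L Φ i)ᵀ := by
  rw [zCov, if_pos rfl, Nat.sub_zero,
    ← sum_Icc_eq_sum_range fun i => arCoef L Φ (i + 0) * (arCoef L Φ i)ᵀ, add_assoc]
  simp only [add_zero, arCoef_zero, Matrix.transpose_one, Matrix.mul_one]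
  congr 2
  refine Finset.sum_congr rfl fun i hi => ?_
  rw [arCoef_of_pos L Φ (Finset.mem_Icc.1 hi).1, Matrix.transpose_neg, neg_mul_neg]

theorem zCov_of_pos {h : ℕ} (h1 : 1 ≤ h) (hp : h ≤ p) : zCov p L Φ Sη h = -phiTilde L Φ h
    + ∑ i ∈ Finset.Icc 1 (p - h), phiTilde L Φ (i + h) * (phiTilde L Φ i)ᵀ := by
  rw [zCov, if_neg (by omega), zero_add, Nat.sub_add_comm hp,
    ← sum_Icc_eq_sum_range fun i => arCoef L Φ (i + h) * (arCoef L Φ i)ᵀ]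
  simp only [zero_add, arCoef_zero, Matrix.transpose_one, Matrix.mul_one, arCoef_of_pos L Φ h1]
  congr 1
  refine Finset.sum_congr rfl fun i hi => ?_
  have hi := (Finset.mem_Icc.1 hi).1
  rw [arCoef_of_pos L Φ hi, arCoef_of_pos L Φ (by omega : 1 ≤ i + h), Matrix.transpose_neg,
    neg_mul_neg]

theorem zCov_of_lt {h : ℕ} (hp : p < h) : zCov p L Φ Sη h = 0 := by
  rw [zCov, if_neg (by omega), show p + 1 - h = 0 by omega, Finset.range_zero, Finset.sum_empty,
    add_zero]

end FactorModel

-- Normalised loadings and the shape of the covariances of `Z`.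

section Loadings

variable {d r p : ℕ} {L : Matrix (Fin d) (Fin r) ℝ} {Φ : ℕ → Matrix (Fin r) (Fin r) ℝ}
  {Sη : Matrix (Fin r) (Fin r) ℝ}

/-- The normalised loadings, with orthonormal columns. -/
def unitLoadings (L : Matrix (Fin d) (Fin r) ℝ) : Matrix (Fin d) (Fin r) ℝ :=
  (1 / Real.sqrt d) • L

theorem conj_unitLoadings (L : Matrix (Fin d) (Fin r) ℝ) (A : Matrix (Fin r) (Fin r) ℝ) :
    unitLoadings L * A * (unitLoadings L)ᵀ = (1 / (d : ℝ)) • (L * A * Lᵀ) := by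
  rw [unitLoadings, Matrix.transpose_smul, Matrix.smul_mul, Matrix.smul_mul, Matrix.mul_smul,
    smul_smul]
  congr 1
  rw [div_mul_div_comm, one_mul, Real.mul_self_sqrt (Nat.cast_nonneg d)]

theorem transpose_mul_unitLoadings (hd : 1 ≤ d)
    (hL : Lᵀ * L = (d : ℝ) • (1 : Matrix (Fin r) (Fin r) ℝ)) :
    (unitLoadings L)ᵀ * unitLoadings L = 1 := by
  have hd0 : (d : ℝ) ≠ 0 := by exact_mod_cast (by omega : d ≠ 0)
  rw [unitLoadings, Matrix.transpose_smul, Matrix.smul_mul, Matrix.mul_smul, smul_smul, hL,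
    smul_smul, div_mul_div_comm, one_mul, Real.mul_self_sqrt (Nat.cast_nonneg d),
    one_div_mul_cancel hd0, one_smul]

theorem phiTilde_eq (L : Matrix (Fin d) (Fin r) ℝ) (Φ : ℕ → Matrix (Fin r) (Fin r) ℝ) (i : ℕ) :
    phiTilde L Φ i = unitLoadings L * Φ i * (unitLoadings L)ᵀ :=
  (conj_unitLoadings L (Φ i)).symm

theorem sum_phiTilde_mul (hQ : (unitLoadings L)ᵀ * unitLoadings L = 1) (s : Finset ℕ) (h : ℕ) :
    ∑ i ∈ s, phiTilde L Φ (i + h) * (phiTilde L Φ i)ᵀ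
      = unitLoadings L * (∑ i ∈ s, Φ (i + h) * (Φ i)ᵀ) * (unitLoadings L)ᵀ := by
  rw [Matrix.mul_sum, Matrix.sum_mul]
  refine Finset.sum_congr rfl fun i _ => ?_
  have h1 := conj_mul_lift_mul_conj hQ (Φ (i + h)) 1 (Φ i)
  rwa [lift_one, Matrix.mul_one, Matrix.mul_one, ← phiTilde_eq, ← phiTilde_eq] at h1

theorem conj_conj {Q : Matrix (Fin d) (Fin r) ℝ} (hQ : Qᵀ * Q = 1)
    (A : Matrix (Fin r) (Fin r) ℝ) : Qᵀ * (Q * A * Qᵀ) * Q = A := by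
  rw [Matrix.mul_assoc, Matrix.mul_assoc (Q * A), hQ, Matrix.mul_one, ← Matrix.mul_assoc, hQ,
    Matrix.one_mul]

theorem conj_lift {Q : Matrix (Fin d) (Fin r) ℝ} (hQ : Qᵀ * Q = 1)
    (A : Matrix (Fin r) (Fin r) ℝ) : Qᵀ * lift Q A * Q = A := by
  have h1 := conj_conj hQ 1
  rw [Matrix.mul_one] at h1
  rw [lift, Matrix.mul_add, Matrix.mul_sub, Matrix.add_mul, Matrix.sub_mul, h1, conj_conj hQ,
    Matrix.mul_one, hQ, sub_self, zero_add]

/-- The summand `1` from `ε_t` is the identity on the complement of the range; the other terms are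
conjugates by `Q`, with `L Sη L'` equal to `Q (d Sη) Q'`. -/
theorem zCov_zero_eq_lift (hd : 1 ≤ d)
    (hL : Lᵀ * L = (d : ℝ) • (1 : Matrix (Fin r) (Fin r) ℝ)) :
    zCov p L Φ Sη 0
      = lift (unitLoadings L) ((unitLoadings L)ᵀ * zCov p L Φ Sη 0 * unitLoadings L) := by
  have hd0 : (d : ℝ) ≠ 0 := by exact_mod_cast (by omega : d ≠ 0)
  have hQ := transpose_mul_unitLoadings hd hL
  have h : zCov p L Φ Sη 0
      = lift (unitLoadings L) (1 + (d : ℝ) • Sη + ∑ i ∈ Finset.Icc 1 p, Φ i * (Φ i)ᵀ) := by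
    have h1 := sum_phiTilde_mul (Φ := Φ) hQ (Finset.Icc 1 p) 0
    have h2 := conj_unitLoadings L ((d : ℝ) • Sη)
    rw [Matrix.mul_smul, Matrix.smul_mul, Matrix.mul_smul, Matrix.smul_mul, smul_smul,
      one_div_mul_cancel hd0, one_smul] at h2
    simp only [add_zero] at h1
    rw [zCov_zero, h1, lift, Matrix.mul_add, Matrix.mul_add, Matrix.add_mul, Matrix.add_mul,
      Matrix.mul_one, Matrix.mul_smul, Matrix.smul_mul, h2]
    abel
  rw [h, conj_lift hQ]

theorem zCov_of_pos_eq_conj (hd : 1 ≤ d)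
    (hL : Lᵀ * L = (d : ℝ) • (1 : Matrix (Fin r) (Fin r) ℝ)) {h : ℕ} (h1 : 1 ≤ h) :
    zCov p L Φ Sη h = unitLoadings L * ((unitLoadings L)ᵀ * zCov p L Φ Sη h * unitLoadings L)
      * (unitLoadings L)ᵀ := by
  have hQ := transpose_mul_unitLoadings hd hL
  -- Any inner matrix will do, since orthonormality forces it to be the compression.
  suffices h : ∃ C : Matrix (Fin r) (Fin r) ℝ,
      zCov p L Φ Sη h = unitLoadings L * C * (unitLoadings L)ᵀ by
    obtain ⟨C, hC⟩ := h
    rw [hC, conj_conj hQ]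
  rcases le_or_gt h p with hp | hp
  · refine ⟨-Φ h + ∑ i ∈ Finset.Icc 1 (p - h), Φ (i + h) * (Φ i)ᵀ, ?_⟩
    rw [zCov_of_pos h1 hp, sum_phiTilde_mul hQ, phiTilde_eq, Matrix.mul_add, Matrix.add_mul,
      Matrix.mul_neg, Matrix.neg_mul]
  · exact ⟨0, by rw [zCov_of_lt hp, Matrix.mul_zero, Matrix.zero_mul]⟩

/-- Explains the choice `U = T - 1` for the limit `T` of the reduced algorithm. -/
theorem lift_eq (L : Matrix (Fin d) (Fin r) ℝ) (A : Matrix (Fin r) (Fin r) ℝ) :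
    lift (unitLoadings L) A = 1 + (1 / (d : ℝ)) • (L * (A - 1) * Lᵀ) := by
  rw [← conj_unitLoadings, lift, Matrix.mul_sub, Matrix.sub_mul, Matrix.mul_one]
  abel

end Loadings

-- White noise and stationarity carried between `L²` and random vectors.

section Transfer

variable {Ω : Type*} [MeasurableSpace Ω] {P : Measure Ω} {m : ℕ}

theorem isWhiteNoise_coeFn [IsFiniteMeasure P] {ζ : ℤ → Fin m → Lp ℝ 2 P}
    {S : Matrix (Fin m) (Fin m) ℝ}
    (hζ : ∀ s t, crossGram (ζ s) (ζ t) = if s = t then S else 0)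
    (h0 : ∀ t i, inner ℝ (Lp.const 2 P (1 : ℝ)) (ζ t i) = 0) :
    IsWhiteNoise P (fun t ω i => ζ t i ω) S where
  memLp t i := (represents_coeFn (ζ t)).memLp i
  mean_zero t i := by rw [← h0 t i, ← (represents_coeFn (ζ t)).integral_eq i]
  cov_self t := by
    rw [(represents_coeFn (ζ t)).crossMoment_eq (represents_coeFn (ζ t)), hζ, if_pos rfl]
  uncorrelated s t hst := by
    rw [(represents_coeFn (ζ s)).crossMoment_eq (represents_coeFn (ζ t)), hζ, if_neg hst]

theorem IsWhiteNoise.crossGram_repr {w : ℤ → Ω → Fin m → ℝ} {S : Matrix (Fin m) (Fin m) ℝ}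
    (hw : IsWhiteNoise P w S) (s t : ℤ) :
    crossGram (repr (w s) (hw.memLp s)) (repr (w t) (hw.memLp t)) = if s = t then S else 0 := by
  rw [← (represents_repr (w s) (hw.memLp s)).crossMoment_eq (represents_repr (w t) (hw.memLp t))]
  split_ifs with h
  · rw [h, hw.cov_self]
  · exact hw.uncorrelated s t h

theorem IsCenteredL2.inner_const_repr [IsFiniteMeasure P] {w : ℤ → Ω → Fin m → ℝ}
    (hw : IsCenteredL2 P w) (t : ℤ) (i : Fin m) :
    inner ℝ (Lp.const 2 P (1 : ℝ)) (repr (w t) (hw.memLp t) i) = 0 := by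
  rw [← (represents_repr (w t) (hw.memLp t)).integral_eq i, hw.mean_zero]

theorem inner_act_eq_zero {H : Type*} [NormedAddCommGroup H] [InnerProductSpace ℝ H] {l : ℕ}
    {v : H} {x : Fin m → H} (hx : ∀ i, inner ℝ v (x i) = 0) (A : Matrix (Fin l) (Fin m) ℝ)
    (i : Fin l) : inner ℝ v (act A x i) = 0 := by
  rw [act, inner_sum, Finset.sum_eq_zero]
  intro j _
  rw [real_inner_smul_right, hx, mul_zero]

theorem isCenteredStationary_of_represents [IsFiniteMeasure P] {Y : ℤ → Ω → Fin m → ℝ}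
    {y : ℤ → Fin m → Lp ℝ 2 P} (h : ∀ t, Represents (Y t) (y t))
    (hy : ∀ s t, crossGram (y s) (y t) = crossGram (y (s - t)) (y 0))
    (h0 : ∀ t i, inner ℝ (Lp.const 2 P (1 : ℝ)) (y t i) = 0) : IsCenteredStationary P Y where
  memLp t i := (h t).memLp i
  mean_zero t i := by rw [(h t).integral_eq i, h0]
  cov_shift s t k := by
    rw [(h _).crossMoment_eq (h _), (h _).crossMoment_eq (h _), hy, hy (t + k) t,
      add_sub_cancel_left, add_sub_cancel_left]

end Transfer

end DFM

end

-- Assembly of the main theorem.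

theorem theorem5p1 {Ω : Type*} [MeasurableSpace Ω] (P : Measure Ω) [IsProbabilityMeasure P]
    (d r p : ℕ) (hd : 1 ≤ d)
    (L : Matrix (Fin d) (Fin r) ℝ) (Φ : ℕ → Matrix (Fin r) (Fin r) ℝ)
    (Sη : Matrix (Fin r) (Fin r) ℝ)
    (X : ℤ → Ω → Fin d → ℝ) (f : ℤ → Ω → Fin r → ℝ)
    (ε : ℤ → Ω → Fin d → ℝ) (η : ℤ → Ω → Fin r → ℝ)
    (hX : DFM.IsDFM P p L Φ 1 Sη X f ε η)
    (hL : Lᵀ * L = (d : ℝ) • (1 : Matrix (Fin r) (Fin r) ℝ))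
    (Z : ℤ → Ω → Fin d → ℝ) (hZ : Z = DFM.zSeries p L Φ ε η)
    (ΓZ : ℤ → Matrix (Fin d) (Fin d) ℝ) (hΓZ : ΓZ = DFM.acvf P Z)
    (ΓW : ℤ → Matrix (Fin r) (Fin r) ℝ) (hΓW : ΓW = DFM.acvf P (DFM.reduced L Z)) :
    -- `Z` is stationary with the explicit autocovariances
    DFM.IsCenteredStationary P Z ∧
    ΓZ 0 = L * Sη * Lᵀ + 1
      + ∑ i ∈ Finset.Icc 1 p, DFM.phiTilde L Φ i * (DFM.phiTilde L Φ i)ᵀ ∧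
    (∀ h : ℕ, 1 ≤ h → h ≤ p → ΓZ h = - DFM.phiTilde L Φ h
      + ∑ i ∈ Finset.Icc 1 (p - h), DFM.phiTilde L Φ (i + h) * (DFM.phiTilde L Φ i)ᵀ) ∧
    (∀ h : ℕ, p < h → ΓZ h = 0) ∧
    -- all matrices inverted by the two innovations algorithms are positive definite
    (∀ n, (DFM.innovSigma ΓZ n).PosDef) ∧
    (∀ n, (DFM.innovSigma ΓW n).PosDef) ∧
    ∃ (Sζ : Matrix (Fin d) (Fin d) ℝ) (Θ : ℕ → Matrix (Fin d) (Fin d) ℝ),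
      -- the VARMA representation
      DFM.IsVARMA P p p (DFM.phiTilde L Φ) Θ Sζ X ∧
      Tendsto (fun n => DFM.innovSigma ΓZ n) atTop (𝓝 Sζ) ∧
      (∀ i, 1 ≤ i → i ≤ p → Tendsto (fun n => DFM.innovTheta ΓZ n i) atTop (𝓝 (Θ i))) ∧
      DFM.IsMaximalSolution ΓZ p Sζ Θ ∧
      -- the low-dimensional form
      ∃ (U : Matrix (Fin r) (Fin r) ℝ) (V : ℕ → Matrix (Fin r) (Fin r) ℝ),
        (1 + U).PosDef ∧
        Sζ = 1 + (1 / (d : ℝ)) • (L * U * Lᵀ) ∧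
        (∀ i, 1 ≤ i → i ≤ p → Θ i = (1 / (d : ℝ)) • (L * V i * Lᵀ)) ∧
        DFM.IsVMA P p V (1 + U) (DFM.reduced L Z) ∧
        Tendsto (fun n => DFM.innovSigma ΓW n - 1) atTop (𝓝 U) ∧
        (∀ i, 1 ≤ i → i ≤ p →
          Tendsto (fun n => DFM.innovTheta ΓW n i) atTop (𝓝 (V i))) := by
  have hf := hX.factors_stationary
  have hεn := hX.errors_whiteNoise
  have hηn := hX.noise_whiteNoise
  set e := fun t => DFM.repr (ε t) (hεn.memLp t) with he_def
  set n := fun t => DFM.repr (η t) (hηn.memLp t) with hn_def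
  set g := fun t => DFM.repr (f t) (hf.memLp t) with hg_def
  have re : ∀ t, DFM.Represents (ε t) (e t) := fun t => DFM.represents_repr _ _
  have rn : ∀ t, DFM.Represents (η t) (n t) := fun t => DFM.represents_repr _ _
  have rg : ∀ t, DFM.Represents (f t) (g t) := fun t => DFM.represents_repr _ _
  have he : ∀ s t, DFM.crossGram (e s) (e t) = if s = t then 1 else 0 := hεn.crossGram_repr
  have hn : ∀ s t, DFM.crossGram (n s) (n t) = if s = t then Sη else 0 := hηn.crossGram_repr
  have heg : ∀ s t, DFM.crossGram (e s) (g t) = 0 := by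
    intro s t
    rw [← (re s).crossMoment_eq (rg t), hX.uncorrelated]
  -- The factor equation writes `η_t` through factors alone, and these are uncorrelated with `ε`.
  have hen : ∀ s t, DFM.crossGram (e s) (n t) = 0 := by
    intro s t
    have h1 : g t = ∑ i ∈ Finset.Icc 1 p, DFM.act (Φ i) (g (t - i)) + n t :=
      (rg t).eq (((DFM.Represents.sum _ fun i => (rg (t - (i : ℕ))).mulVec (Φ i)).add (rn t)).congr
        ((hX.factors_var t).mono fun ω hω => hω.symm))
    rw [eq_sub_of_add_eq' h1.symm, DFM.crossGram_sub_right, heg, DFM.crossGram_sum_right,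
      Finset.sum_eq_zero, sub_zero]
    intro i _
    rw [DFM.crossGram_act_right, heg, Matrix.zero_mul]
  set z := DFM.zVec p L Φ e n with hz_def
  have rz : ∀ t, DFM.Represents (Z t) (z t) := by
    intro t
    rw [hZ, hz_def, DFM.zVec_eq]
    exact (((rn t).mulVec L).add (re t)).sub
      (DFM.Represents.sum _ fun i => (re (t - (i : ℕ))).mulVec (DFM.phiTilde L Φ i))
  set Q := DFM.unitLoadings L with hQ_def
  have hQ : Qᵀ * Q = 1 := DFM.transpose_mul_unitLoadings hd hL
  have rw' : ∀ t, DFM.Represents (DFM.reduced L Z t) (DFM.act Qᵀ (z t)) := by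
    intro t
    refine ((rz t).mulVec Qᵀ).congr (ae_of_all _ fun ω => ?_)
    rw [hQ_def, DFM.unitLoadings, Matrix.transpose_smul, Matrix.smul_mulVec, DFM.reduced]
  have hzz := DFM.crossGram_zVec (p := p) (L := L) (Φ := Φ) he hn hen
  have hcov : ∀ h : ℕ, ΓZ h = DFM.zCov p L Φ Sη h := by
    intro h
    have h1 := hzz 0 h
    rw [zero_add] at h1
    rw [hΓZ, DFM.acvf, (rz h).crossMoment_eq (rz 0), h1]
  have hzstat : ∀ s t, DFM.crossGram (z s) (z t) = DFM.crossGram (z (s - t)) (z 0) :=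
    DFM.crossGram_eq_of_natCast hzz
  have hzΓ : ∀ s t, DFM.crossGram (z s) (z t) = ΓZ (s - t) := by
    intro s t
    rw [hzstat, hΓZ, DFM.acvf, (rz _).crossMoment_eq (rz 0)]
  have hwz : ∀ s t, DFM.crossGram (DFM.act Qᵀ (z s)) (DFM.act Qᵀ (z t)) = Qᵀ * ΓZ (s - t) * Q := by
    intro s t
    rw [DFM.crossGram_act_left, DFM.crossGram_act_right, hzΓ, Matrix.transpose_transpose,
      Matrix.mul_assoc]
  have hΓWZ : ∀ h, ΓW h = Qᵀ * ΓZ h * Q := by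
    intro h
    rw [hΓW, DFM.acvf, (rw' h).crossMoment_eq (rw' 0), hwz, sub_zero]
  have hwΓ : ∀ s t, DFM.crossGram (DFM.act Qᵀ (z s)) (DFM.act Qᵀ (z t)) = ΓW (s - t) := by
    intro s t
    rw [hwz, hΓWZ]
  obtain ⟨hpast, hpresent⟩ := DFM.crossGram_zVec_error (p := p) (L := L) (Φ := Φ) he hen 0
  have hZp : ∀ h : ℕ, p < h → ΓZ h = 0 := fun h hh => by rw [hcov, DFM.zCov_of_lt hh]
  have hWp : ∀ h : ℕ, p < h → ΓW h = 0 := fun h hh => by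
    rw [hΓWZ, hZp h hh, Matrix.mul_zero, Matrix.zero_mul]
  have hZone : ∀ k, (DFM.innovSigma ΓZ k - 1).PosSemidef :=
    DFM.innovSigma_sub_one_posSemidef hzΓ hpast hpresent (by rw [he, if_pos rfl])
  have hWone : ∀ k, (DFM.innovSigma ΓW k - 1).PosSemidef := by
    -- The noise `Q' ε_0` has identity covariance because the columns of `Q` are orthonormal.
    refine DFM.innovSigma_sub_one_posSemidef hwΓ (w := DFM.act Qᵀ (e 0)) (fun s hs => ?_) ?_ ?_
    · rw [DFM.crossGram_act_left, DFM.crossGram_act_right, hpast s hs, Matrix.zero_mul,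
        Matrix.mul_zero]
    · rw [DFM.crossGram_act_left, DFM.crossGram_act_right, hpresent, Matrix.one_mul,
        Matrix.transpose_transpose, hQ]
    · rw [DFM.crossGram_act_left, DFM.crossGram_act_right, he, if_pos rfl, Matrix.one_mul,
        Matrix.transpose_transpose, hQ]
  have hWu : ∀ k, IsUnit (DFM.innovSigma ΓW k).det := fun k =>
    DFM.isUnit_det_of_posDef (DFM.posDef_of_sub_one (hWone k))
  have h0lift : ΓZ 0 = DFM.lift Q (ΓW 0) := by
    have h1 := hcov 0
    rw [Nat.cast_zero] at h1
    rw [hΓWZ, h1]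
    exact DFM.zCov_zero_eq_lift hd hL
  have hposlift : ∀ h : ℕ, 1 ≤ h → ΓZ h = Q * ΓW h * Qᵀ := by
    intro h hh
    rw [hΓWZ, hcov]
    exact DFM.zCov_of_pos_eq_conj hd hL hh
  have hz0 : ∀ t i, inner ℝ (Lp.const 2 P (1 : ℝ)) (z t i) = 0 := by
    intro t i
    rw [hz_def, DFM.zVec, Pi.add_apply, inner_add_right, Finset.sum_apply, inner_sum,
      DFM.inner_act_eq_zero (hηn.inner_const_repr t), Finset.sum_eq_zero, zero_add]
    intro j _
    exact DFM.inner_act_eq_zero (hεn.inner_const_repr _) _ _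
  have hw0 : ∀ t i, inner ℝ (Lp.const 2 P (1 : ℝ)) (DFM.act Qᵀ (z t) i) = 0 := fun t =>
    DFM.inner_act_eq_zero (hz0 t) _
  obtain ⟨S, Θ, ζ, -, hS, hΘ, hmax, hζ, hzζ, hζ0⟩ := DFM.exists_movingAverage hzΓ hZp hZone
  obtain ⟨T, V, ξ, hT1, hT, hV, -, hξ, hwξ, hξ0⟩ := DFM.exists_movingAverage hwΓ hWp hWone
  have hlift : ∀ k, DFM.innovSigma ΓZ k = DFM.lift Q (DFM.innovSigma ΓW k) := fun k =>
    (DFM.innov_lift hQ h0lift hposlift hWu k).2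
  refine ⟨DFM.isCenteredStationary_of_represents rz hzstat hz0, ?_, fun h h1 hp => ?_, hZp,
    fun k => DFM.posDef_of_sub_one (hZone k), fun k => DFM.posDef_of_sub_one (hWone k), S, Θ,
    ⟨_, DFM.isWhiteNoise_coeFn hζ (hζ0 _ hz0), fun t => ?_⟩, hS, fun i hi _ => hΘ i hi, hmax,
    T - 1, V, ?_, ?_, fun i hi _ => ?_, ⟨fun t ω i => ξ t i ω, ?_, fun t => ?_⟩,
    hT.sub_const 1, fun i hi _ => hV i hi⟩
  · rw [← DFM.zCov_zero, ← hcov, Nat.cast_zero]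
  · rw [hcov, DFM.zCov_of_pos h1 hp]
  · have r1 : DFM.Represents (Z t)
        (ζ t + ∑ i ∈ Finset.Icc 1 p, DFM.act (Θ i) (ζ (t - i))) := by
      rw [← hzζ]
      exact rz t
    have hae := r1.ae_eq ((DFM.represents_coeFn (ζ t)).add (DFM.Represents.sum _ fun i =>
      (DFM.represents_coeFn (ζ (t - (i : ℕ)))).mulVec (Θ i)))
    filter_upwards [hae, ae_all_iff.2 hX.model, hX.factors_var t] with ω h1 h2 h3
    rw [add_assoc, ← h1, hZ, DFM.zSeries, h2 t, h3, Matrix.mulVec_add]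
    have hd0 : (d : ℝ) ≠ 0 := by exact_mod_cast (by omega : d ≠ 0)
    -- This is `Φ̃_i L = L Φ_i`, a consequence of `L' L = d I`.
    have h4 : ∀ i, DFM.phiTilde L Φ i *ᵥ X (t - (i : ℕ)) ω
        = L *ᵥ (Φ i *ᵥ f (t - i) ω) + DFM.phiTilde L Φ i *ᵥ ε (t - i) ω := by
      intro i
      rw [h2, Matrix.mulVec_add, Matrix.mulVec_mulVec, Matrix.mulVec_mulVec, DFM.phiTilde,
        Matrix.smul_mul, Matrix.mul_assoc, hL, Matrix.mul_smul, Matrix.mul_one, smul_smul,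
        one_div_mul_cancel hd0, one_smul]
    simp only [h4, Finset.sum_add_distrib, Matrix.mulVec_sum]
    abel
  · rw [add_sub_cancel]
    exact DFM.posDef_of_sub_one hT1
  · rw [← DFM.lift_eq]
    -- The two algorithms agree at every finite stage up to the continuous map `lift Q`, so their
    -- limits do too.
    refine tendsto_nhds_unique hS (Tendsto.congr (fun k => (hlift k).symm) ?_)
    exact ((DFM.continuous_lift Q).tendsto T).comp hT
  · rw [← DFM.conj_unitLoadings]
    refine tendsto_nhds_unique (hΘ i hi) (Tendsto.congr
      (fun k => (DFM.innovTheta_lift hQ h0lift hposlift hWu k hi).symm) ?_)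
    exact ((DFM.continuous_conj Q).tendsto (V i)).comp (hV i hi)
  · rw [add_sub_cancel]
    exact DFM.isWhiteNoise_coeFn hξ (hξ0 _ hw0)
  · have r1 : DFM.Represents (DFM.reduced L Z t)
        (ξ t + ∑ i ∈ Finset.Icc 1 p, DFM.act (V i) (ξ (t - i))) := by
      rw [← hwξ]
      exact rw' t
    filter_upwards [r1.ae_eq ((DFM.represents_coeFn (ξ t)).add (DFM.Represents.sum _ fun i =>
      (DFM.represents_coeFn (ξ (t - (i : ℕ)))).mulVec (V i)))] with ω h1
    rw [h1]
    simp
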